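/- Let $A\ge 1$ be an integer, let $\mathcal A$ be a set of $A$ outcomes, $\mathcal P=\Delta(\mathcal A)\subset\mathbb R^{A}$ the set of probability distributions over $\mathcal A$, and $\delta_a$ the Dirac distribution on $a$. At each round $t=1,2,\dots$ a randomized forecaster draws $P_t\in\mathcal P$ from a law that depends on the past forecasts and outcomes, while Nature simultaneously chooses $a_t\in\mathcal A$ by an arbitrary (adaptive, possibly randomized) strategy. For $\varepsilon>0$, an $\varepsilon$-grid is a finite set $G\subset\mathcal P$ such that the closed $\ell^1$-balls of radius $\varepsilon$ centered at the points of $G$ cover $\mathcal P$. For $p\in G$ and $a\in\mathcal A$ let $m(p,a)\in(\mathbb R^{A})^{G}$ have component $p-\delta_a$ at $p$ and $0$ elsewhere, extend $m(\cdot,a)$ linearly to probability distributions on $G$, and let $C=\{x\in(\mathbb R^{A})^{G}:\sum_{p\in G}\|x_p\|_1\le\varepsilon\}$, with Euclidean projection $\Pi_C$. An approachability forecaster on $G$ (with radius $\varepsilon$) only plays points of $G$ and, after any history with average payoff $\overline m$ (with $\overline m=0$ for the empty history), draws its next forecast from a distribution $\psi$ on $G$ such that $(\overline m-\Pi_C(\overline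 m))\cdot(m(\psi,a)-\Pi_C(\overline m))\le 0$ for all $a\in\mathcal A$. A forecaster that only plays points of $G$ is called $\varepsilon$-calibrated if, against all strategies of Nature, almost surely $$\limsup_{T\to\infty}\ \sum_{p\in G}\Bigl\|\frac1T\sum_{t=1}^T\mathbf 1_{\{P_t=p\}}(p-\delta_{a_t})\Bigr\|_1\le\varepsilon .$$ Then the following holds. 1. There is a constant $c_A$ depending only on $A$ such that for every $0<\varepsilon\le1$ there is an $\varepsilon$-grid with at most $c_A\,\varepsilon^{-(A-1)}$ points; and on every $\varepsilon$-grid ($\varepsilon>0$) there is an approachability forecaster with radius $\varepsilon$. 2. For every $c$ there is a constant $\Gamma$, depending only on $A$ and $c$ (hence only on $A$ when $c=c_A$), with the following property. Put $\varepsilon_r=2^{-r/(A+1)}$ for $r\ge1$, let $G_r$ be any $\varepsilon_r$-grid with at most $c\,\varepsilon_r^{-(A-1)}$ points, and let $\varphi_r$ be any approachability forecaster on $G_r$ with radius $\varepsilon_r$. Then each $\varphi_r$ is $\varepsilon_r$-calibrated. Moreover, consider the meta-forecaster that proceeds in consecutive regimes $r=1,2,\dots$ of length $T_r=2^r$ and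 uses in regime $r$ the forecaster $\varphi_r$, started afresh at the beginning of the regime. Against all strategies of Nature, almost surely, $$\lim_{T\to\infty}\ \sup_{B}\Bigl\|\frac1T\sum_{t=1}^T\mathbf 1_{\{P_t\in B\}}(P_t-\delta_{a_t})\Bigr\|_1=0$$ and $$\limsup_{T\to\infty}\ \frac{T^{1/(A+1)}}{\sqrt{\ln T}}\ \sup_{B}\Bigl\|\frac1T\sum_{t=1}^T\mathbf 1_{\{P_t\in B\}}(P_t-\delta_{a_t})\Bigr\|_1\le\Gamma ,$$ where the suprema are over all Borel subsets $B$ of $\mathcal P$. -/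

import Mathlib

open Filter Topology MeasureTheory

namespace Calibration

universe u w

/-- The set of probability distributions over the finite set `𝒜` of outcomes, with the topology and
the Borel sigma-algebra inherited from `ℝ^𝒜`. -/
abbrev Prob (𝒜 : Type u) [Fintype 𝒜] : Type u := stdSimplex ℝ 𝒜

section Basic

variable {𝒜 : Type u} [Fintype 𝒜]

/-- The `ℓ¹` norm of `x ∈ ℝ^𝒜`. -/
def l1 (x : 𝒜 → ℝ) : ℝ := ∑ b, |x b|

open Classical in
/-- The Dirac distribution on the outcome `a`, as a vector of `ℝ^𝒜`. -/
noncomputable def dirac (a : 𝒜) : 𝒜 → ℝ := Pi.single a 1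

/-- A (randomized) forecaster: to each finite history of past pairs (forecast, outcome), in
chronological order, it associates the law of its next forecast. -/
def Forecaster (𝒜 : Type u) [Fintype 𝒜] : Type u := List (Prob 𝒜 × 𝒜) → PMF (Prob 𝒜)

/-- The history of the first `n` rounds. Round `t ≥ 1` has index `t - 1`: its forecast is
`P (t - 1)` and its outcome is `a (t - 1)`. -/
def history {Ω : Type w} (P : ℕ → Ω → Prob 𝒜) (a : ℕ → Ω → 𝒜) (n : ℕ) (ω : Ω) :
    List (Prob 𝒜 × 𝒜) :=
  (List.range n).map fun i => (P i ω, a i ω)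

/-- `(P, a)` is a play of the forecaster `φ` against some strategy of Nature: given the past history
`h` and the outcome `b` chosen by Nature for the current round, the forecast of the current round
has law `φ h`. In particular forecast and outcome are chosen simultaneously (independently given the
past). Nothing is assumed about the way Nature chooses its outcomes from the past, possibly at
random. -/
structure IsPlay (φ : Forecaster 𝒜) {Ω : Type w} [MeasurableSpace Ω] (μ : Measure Ω)
    (P : ℕ → Ω → Prob 𝒜) (a : ℕ → Ω → 𝒜) : Prop where
  measurable_forecast : ∀ n, Measurable (P n)
  measurable_outcome : ∀ n b, MeasurableSet {ω | a n ω = b}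
  law : ∀ (n : ℕ) (h : List (Prob 𝒜 × 𝒜)) (b : 𝒜) (p : Prob 𝒜),
    μ {ω | history P a n ω = h ∧ a n ω = b ∧ P n ω = p}
      = μ {ω | history P a n ω = h ∧ a n ω = b} * φ h p

open Classical in
/-- The vector `(1/T) ∑_{t ≤ T} 1{P_t ∈ B} (P_t - δ_{a_t})` for a sequence of forecasts `P` and a
sequence of outcomes `a`. -/
noncomputable def calVec (P : ℕ → Prob 𝒜) (a : ℕ → 𝒜) (T : ℕ) (B : Set (Prob 𝒜)) : 𝒜 → ℝ :=
  (T : ℝ)⁻¹ • ∑ t ∈ Finset.range T,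
    if P t ∈ B then (P t : 𝒜 → ℝ) - dirac (a t) else 0

/-- The supremum over Borel sets `B` of the `ℓ¹` norm of
`(1/T) ∑_{t ≤ T} 1{P_t ∈ B} (P_t - δ_{a_t})`. -/
noncomputable def unifScore (P : ℕ → Prob 𝒜) (a : ℕ → 𝒜) (T : ℕ) : ℝ :=
  ⨆ B : {B : Set (Prob 𝒜) // MeasurableSet B}, l1 (calVec P a T B)

/-- The finite set `G` is an `ε`-grid of the simplex for the `ℓ¹` norm: the closed balls of radius
`ε` centered at the points of `G` cover the simplex. -/
def IsGrid (ε : ℝ) (G : Finset (Prob 𝒜)) : Prop :=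
  ∀ q : Prob 𝒜, ∃ p ∈ G, l1 ((p : 𝒜 → ℝ) - (q : 𝒜 → ℝ)) ≤ ε

/-- The forecaster only selects points of `G`. -/
def PlaysIn (φ : Forecaster 𝒜) (G : Finset (Prob 𝒜)) : Prop :=
  ∀ h : List (Prob 𝒜 × 𝒜), (∀ x ∈ h, x.1 ∈ G) → (φ h).support ⊆ G

/-- `φ` is an `ε`-calibrated forecaster (`ℓ¹` norm) selecting its forecasts in the `ε`-grid `G`:
against all strategies of Nature, almost surely,
`limsup_T ∑_{p ∈ G} ‖(1/T) ∑_{t ≤ T} 1{P_t = p} (p - δ_{a_t})‖₁ ≤ ε`. -/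
def IsEpsCalibrated (ε : ℝ) (G : Finset (Prob 𝒜)) (φ : Forecaster 𝒜) : Prop :=
  IsGrid ε G ∧ PlaysIn φ G ∧
    ∀ (Ω : Type w) [MeasurableSpace Ω] (μ : Measure Ω) [IsProbabilityMeasure μ]
      (P : ℕ → Ω → Prob 𝒜) (a : ℕ → Ω → 𝒜), IsPlay φ μ P a →
      ∀ᵐ ω ∂μ, limsup (fun T : ℕ =>
        ((∑ p ∈ G, l1 (calVec (fun t => P t ω) (fun t => a t ω) T {p}) : ℝ) : EReal)) atTop
          ≤ (ε : EReal)

/-- The space `ℝ^{A N}` of vector payoffs, with its Euclidean norm, where `N` is the cardinality of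
the grid `G`. -/
abbrev PayoffSpace (G : Finset (Prob 𝒜)) : Type u := EuclideanSpace ℝ (G × 𝒜)

open Classical in
/-- The vector payoff `m(p, a)`: its component (a vector of `ℝ^𝒜`) at the grid point `p` is
`p - δ_a`, the components at all other grid points are zero. -/
noncomputable def payoff (G : Finset (Prob 𝒜)) (p : Prob 𝒜) (a : 𝒜) : PayoffSpace G :=
  WithLp.toLp 2 fun x : G × 𝒜 => if (x.1 : Prob 𝒜) = p then (p : 𝒜 → ℝ) x.2 - dirac a x.2 else 0

/-- The average payoff along a history (zero for the empty history). -/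
noncomputable def avgPayoff (G : Finset (Prob 𝒜)) (h : List (Prob 𝒜 × 𝒜)) : PayoffSpace G :=
  (h.length : ℝ)⁻¹ • (h.map fun x => payoff G x.1 x.2).sum

/-- The target set: the `ε`-ball around zero for the norm `∑_{p ∈ G} ‖x_p‖₁`. -/
def target (G : Finset (Prob 𝒜)) (ε : ℝ) : Set (PayoffSpace G) :=
  {x | ∑ p : G, l1 (fun b => x (p, b)) ≤ ε}

/-- `π` is the projection (for the norm of `E`) of `x` onto the set `C`. -/
def IsProjection {E : Type*} [NormedAddCommGroup E] (C : Set E) (x π : E) : Prop :=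
  π ∈ C ∧ ∀ y ∈ C, ‖x - π‖ ≤ ‖x - y‖

/-- `φ` is an approachability (Blackwell) forecaster on the grid `G` for the target set of radius
`ε`: it selects points of `G` and, after each history `h` with average payoff `m̄`, the law `ψ = φ h`
of its next forecast satisfies `(m̄ - Π m̄) · (m(ψ, a) - Π m̄) ≤ 0` for all outcomes `a`, where `Π` is
the Euclidean projection onto the target set. After the empty history the condition is void, as then
`m̄ = Π m̄ = 0`. -/
def IsBlackwell (ε : ℝ) (G : Finset (Prob 𝒜)) (φ : Forecaster 𝒜) : Prop :=
  PlaysIn φ G ∧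
    ∀ h : List (Prob 𝒜 × 𝒜), (∀ x ∈ h, x.1 ∈ G) →
      ∃ π : PayoffSpace G, IsProjection (target G ε) (avgPayoff G h) π ∧
        ∀ a : 𝒜, inner ℝ (avgPayoff G h - π)
          ((∑ p ∈ G, (φ h p).toReal • payoff G p a) - π) ≤ 0

end Basic

/-- The number of rounds before regime `r`, regime `s ≥ 1` having length `2 ^ s`. -/
def regimeStart (r : ℕ) : ℕ := ∑ s ∈ Finset.Ico 1 r, 2 ^ s

/-- The regime of the round that comes after `n` past rounds. -/
def regime (n : ℕ) : ℕ := Nat.log 2 (n + 2)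

theorem regimeStart_add_two (r : ℕ) (hr : 1 ≤ r) : regimeStart r + 2 = 2 ^ r := by
  induction r, hr using Nat.le_induction with
  | base => simp [regimeStart]
  | succ k hk ih =>
    have : regimeStart (k + 1) = regimeStart k + 2 ^ k := by
      simp [regimeStart, Finset.sum_Ico_succ_top hk]
    rw [this, pow_succ]; omega

/-- The round that comes after `n` past rounds lies in regime `regime n`. -/
theorem regime_spec (n : ℕ) : 1 ≤ regime n ∧ regimeStart (regime n) ≤ n ∧
    n < regimeStart (regime n) + 2 ^ regime n := by
  have h1 : 1 ≤ regime n := Nat.log_pos (by norm_num) (by omega)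
  have h2 := regimeStart_add_two _ h1
  have h3 : 2 ^ regime n ≤ n + 2 := Nat.pow_log_le_self 2 (by omega)
  have h4 : n + 2 < 2 ^ (regime n + 1) := Nat.lt_pow_succ_log_self (by norm_num) _
  rw [pow_succ] at h4
  exact ⟨h1, by omega, by omega⟩

/-- The meta-forecaster: in regime `r = 1, 2, …`, which lasts `2 ^ r` rounds, it resorts to the
forecaster `φ r`, restarted at the beginning of the regime. -/
def metaForecaster {𝒜 : Type u} [Fintype 𝒜] (φ : ℕ → Forecaster 𝒜) : Forecaster 𝒜 :=
  fun h => φ (regime h.length) (h.drop (regimeStart (regime h.length)))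

/-- The accuracy `ε_r = 2^{-r/(A+1)}` used in regime `r`. -/
noncomputable def regimeEps (A r : ℕ) : ℝ := (2 : ℝ) ^ (-(r : ℝ) / ((A : ℝ) + 1))

end Calibration

open Calibration

universe u w

namespace Calibration

/-! A forecaster that knew the law q of the next outcome would play a grid point within ε of q, and
its mean payoff would lie in the target. Minimax turns these answers into one mixed forecast that
meets Blackwell's condition against all outcomes (`exists_approachability_law`).

Let D be the number of rounds times the distance of the average payoff to the target. By Blackwell's
condition, D² grows by at most 9 + 2Y per round, where Y has nonpositive mean and |Y| ≤ 3D
(`IsBlackwell.exists_deviation_append_le`). Hence suitable exponential moments of D² stay bounded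
over T rounds, and D² ≥ x has probability at most exp(1 - x/(36T))
(`IsPlay.measure_le_deviation_sq`). Borel–Cantelli then gives calibration of a single forecaster
and, for almost every play of the meta-forecaster, D ≤ √(72 k 2^k) throughout every late regime k.

Since D does not involve B, the unnormalized error after t rounds is at most t ε + √(N A) D for all
B at once, N being the number of grid points. When N ≤ c ε^(-(A-1)), the choice ε_k = 2^(-k/(A+1))
makes both terms of order g^k, up to √k, with g = 2^(A/(A+1)). These errors add up geometrically to
order √r g^r; for T in regime r, g^r / T is at most of order T^(-1/(A+1)) and √r at most of order
√(ln T). -/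

theorem exists_mixed_of_forall_mixed {ι κ : Type*} [Fintype ι] [Fintype κ] [Nonempty ι]
    [Nonempty κ] (M : ι → κ → ℝ)
    (h : ∀ q ∈ stdSimplex ℝ κ, ∃ i, ∑ k, q k * M i k ≤ 0) :
    ∃ x ∈ stdSimplex ℝ ι, ∀ k, ∑ i, x i * M i k ≤ 0 := by
  classical
  obtain ⟨i₀⟩ := ‹Nonempty ι›
  obtain ⟨k₀⟩ := ‹Nonempty κ›
  have hlin₁ (y : κ → ℝ) : ∃ L : (ι → ℝ) →ₗ[ℝ] ℝ, ∀ x, L x = ∑ i, x i * ∑ k, y k * M i k :=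
    ⟨∑ i, (∑ k, y k * M i k) • LinearMap.proj i, fun x => by
      simp [LinearMap.sum_apply, mul_comm]⟩
  have hlin₂ (x : ι → ℝ) : ∃ L : (κ → ℝ) →ₗ[ℝ] ℝ, ∀ y, L y = ∑ i, x i * ∑ k, y k * M i k :=
    ⟨∑ i, x i • ∑ k, M i k • LinearMap.proj k, fun y => by
      simp [LinearMap.sum_apply, mul_comm]⟩
  obtain ⟨x, hx, y, hy, hxy⟩ := Sion.exists_isSaddlePointOn (X := stdSimplex ℝ ι)
    (Y := stdSimplex ℝ κ) (f := fun x y => ∑ i, x i * ∑ k, y k * M i k)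
    ⟨_, single_mem_stdSimplex ℝ i₀⟩ (convex_stdSimplex ℝ ι) (isCompact_stdSimplex ℝ ι)
    (fun y _ => (Continuous.lowerSemicontinuous (by fun_prop)).lowerSemicontinuousOn _)
    (fun y _ => by
      obtain ⟨L, hL⟩ := hlin₁ y
      simp only [← hL]
      exact (L.convexOn (convex_stdSimplex ℝ ι)).quasiconvexOn)
    (convex_stdSimplex ℝ κ) ⟨_, single_mem_stdSimplex ℝ k₀⟩ (isCompact_stdSimplex ℝ κ)
    (fun x _ => (Continuous.upperSemicontinuous (by fun_prop)).upperSemicontinuousOn _)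
    (fun x _ => by
      obtain ⟨L, hL⟩ := hlin₂ x
      simp only [← hL]
      exact (L.concaveOn (convex_stdSimplex ℝ κ)).quasiconcaveOn)
  refine ⟨x, hx, fun k => ?_⟩
  obtain ⟨i, hi⟩ := h y hy
  -- The saddle point compares x against the pure k with the pure i against y; the latter is
  -- nonpositive because i answers y.
  have := hxy _ (single_mem_stdSimplex ℝ i) _ (single_mem_stdSimplex ℝ k)
  simp only [Pi.single_apply, ite_mul, one_mul, zero_mul, Finset.sum_ite_eq', Finset.mem_univ,
    if_true] at this
  linarith

/-! ### Grids of the simplex and existence of approachability forecasters -/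

section Basic

variable {𝒜 : Type u} [Fintype 𝒜]

theorem l1_nonneg (x : 𝒜 → ℝ) : 0 ≤ l1 x := Finset.sum_nonneg fun _ _ => abs_nonneg _

theorem l1_add_le (x y : 𝒜 → ℝ) : l1 (x + y) ≤ l1 x + l1 y := by
  unfold l1
  rw [← Finset.sum_add_distrib]
  exact Finset.sum_le_sum fun _ _ => abs_add_le _ _

theorem l1_zero : l1 (0 : 𝒜 → ℝ) = 0 := by simp [l1]

theorem l1_sum_le {ι : Type*} (s : Finset ι) (f : ι → 𝒜 → ℝ) :
    l1 (∑ i ∈ s, f i) ≤ ∑ i ∈ s, l1 (f i) :=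
  Finset.le_sum_of_subadditive l1 l1_zero.le l1_add_le s f

theorem l1_smul (c : ℝ) (x : 𝒜 → ℝ) : l1 (c • x) = |c| * l1 x := by
  simp [l1, abs_mul, Finset.mul_sum]

/-- Round every coordinate but one, at a₀, down to a multiple of 1/N and give the lost mass to a₀.
Each rounding loses at most 1/N and the gain at a₀ doubles the total, so N ≥ 2A/ε suffices. -/
theorem exists_grid [Nonempty 𝒜] {ε : ℝ} (h0 : 0 < ε) (h1 : ε ≤ 1) :
    ∃ G : Finset (Prob 𝒜), IsGrid ε G ∧
      (G.card : ℝ) ≤ ((2 * Fintype.card 𝒜 + 2 : ℝ) / ε) ^ (Fintype.card 𝒜 - 1) := by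
  classical
  obtain ⟨a₀⟩ := ‹Nonempty 𝒜›
  set A := Fintype.card 𝒜 with hA
  have hA1 : 1 ≤ A := Fintype.card_pos_iff.2 ⟨a₀⟩
  have hA1' : (1 : ℝ) ≤ A := by exact_mod_cast hA1
  set N := ⌈2 * A / ε⌉₊ with hN
  have hNε : 2 * A / ε ≤ N := Nat.le_ceil _
  have hN0 : (0 : ℝ) < N := lt_of_lt_of_le (by positivity) hNε
  let S := {a : 𝒜 // a ≠ a₀}
  have hS : Fintype.card S = A - 1 := by
    simp [S, hA, Fintype.card_subtype_compl]
  let v (k : S → Fin (N + 1)) (a : 𝒜) : ℝ :=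
    if h : a = a₀ then 1 - ∑ s : S, (k s : ℝ) / N else (k ⟨a, h⟩ : ℝ) / N
  have split (f : 𝒜 → ℝ) : ∑ a, f a = f a₀ + ∑ s : S, f s := by
    rw [Fintype.sum_eq_add_sum_subtype_ne f a₀]
  have vS (k : S → Fin (N + 1)) (s : S) : v k s = (k s : ℝ) / N := by
    simp [v, s.2]
  have va (k : S → Fin (N + 1)) : v k a₀ = 1 - ∑ s : S, (k s : ℝ) / N := by
    simp [v]
  -- Tuples leaving negative mass at a₀ are sent to a Dirac mass; this is harmless, as only an upper
  -- bound on the number of points is needed.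
  let g (k : S → Fin (N + 1)) : Prob 𝒜 :=
    if h : v k ∈ stdSimplex ℝ 𝒜 then ⟨v k, h⟩ else ⟨_, single_mem_stdSimplex ℝ a₀⟩
  refine ⟨Finset.univ.image g, fun q => ?_, ?_⟩
  · have q0 (a : 𝒜) : 0 ≤ q.1 a := q.2.1 a
    have q1 (a : 𝒜) : q.1 a ≤ 1 := stdSimplex.le_one q a
    have hk (s : S) : ⌊N * q.1 s⌋₊ < N + 1 := by
      rw [Nat.lt_succ_iff]
      refine Nat.floor_le_of_le ?_
      have := mul_le_mul_of_nonneg_left (q1 s) hN0.le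
      linarith
    let k : S → Fin (N + 1) := fun s => ⟨⌊N * q.1 s⌋₊, hk s⟩
    have le1 (s : S) : (k s : ℝ) / N ≤ q.1 s := by
      rw [div_le_iff₀ hN0, mul_comm]
      exact Nat.floor_le (mul_nonneg hN0.le (q0 s))
    have le2 (s : S) : q.1 s - (k s : ℝ) / N ≤ 1 / N := by
      rw [sub_le_iff_le_add, ← add_div, le_div_iff₀ hN0, mul_comm, add_comm]
      exact (Nat.lt_floor_add_one _).le
    have hq : q.1 a₀ = 1 - ∑ s : S, q.1 s := by
      have h := q.2.2
      rw [split] at h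
      linarith
    have hv : v k ∈ stdSimplex ℝ 𝒜 := by
      refine ⟨fun a => ?_, ?_⟩
      · by_cases h : a = a₀
        · subst h
          rw [va]
          have : ∑ s : S, (k s : ℝ) / N ≤ ∑ s : S, q.1 s := Finset.sum_le_sum fun s _ => le1 s
          linarith [q0 a]
        · rw [vS k ⟨a, h⟩]
          positivity
      · rw [split, va]
        simp only [vS]
        ring
    refine ⟨g k, Finset.mem_image_of_mem _ (Finset.mem_univ _), ?_⟩
    have hg : ((g k : Prob 𝒜) : 𝒜 → ℝ) = v k := by
      simp only [g, dif_pos hv]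
      rfl
    rw [hg, l1, split]
    change |(v k - q.1) a₀| + ∑ s : S, |(v k - q.1) s| ≤ ε
    have e1 : |(v k - q.1) a₀| = ∑ s : S, (q.1 s - (k s : ℝ) / N) := by
      rw [Pi.sub_apply, va, hq, Finset.sum_sub_distrib, abs_of_nonneg]
      · ring
      · have : ∑ s : S, (k s : ℝ) / N ≤ ∑ s : S, q.1 s := Finset.sum_le_sum fun s _ => le1 s
        linarith
    have e2 (s : S) : |(v k - q.1) s| = q.1 s - (k s : ℝ) / N := by
      rw [Pi.sub_apply, vS, abs_sub_comm, abs_of_nonneg (by linarith [le1 s])]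
    have e3 : ∑ s : S, (q.1 s - (k s : ℝ) / N) ≤ A * (1 / N) := by
      refine (Finset.sum_le_sum fun s _ => le2 s).trans ?_
      rw [Finset.sum_const, nsmul_eq_mul, Finset.card_univ, hS]
      gcongr
      omega
    rw [e1, Finset.sum_congr rfl fun s _ => e2 s]
    have : 2 * (A : ℝ) / N ≤ ε := by
      rw [div_le_iff₀ h0] at hNε
      rw [div_le_iff₀ hN0]
      linarith
    calc _ ≤ A * (1 / (N : ℝ)) + A * (1 / (N : ℝ)) := add_le_add e3 e3
      _ = 2 * (A : ℝ) / N := by ring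
      _ ≤ ε := this
  · have hcard : (Finset.univ.image g).card ≤ (N + 1) ^ (A - 1) := by
      refine Finset.card_image_le.trans ?_
      rw [Finset.card_univ, Fintype.card_fun, Fintype.card_fin, hS]
    calc ((Finset.univ.image g).card : ℝ) ≤ ((N : ℝ) + 1) ^ (A - 1) := by exact_mod_cast hcard
      _ ≤ _ := by
        gcongr
        have := (Nat.ceil_lt_add_one (show 0 ≤ 2 * A / ε by positivity)).le
        have h2 : 2 ≤ 2 / ε := by rw [le_div_iff₀ h0]; linarith
        rw [add_div]
        linarith

theorem exists_grid_card_le {A : ℕ} (hA : 1 ≤ A) :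
    ∃ c : ℝ, ∀ (𝒜 : Type u) [Fintype 𝒜], Fintype.card 𝒜 = A →
      ∀ ε : ℝ, 0 < ε → ε ≤ 1 →
        ∃ G : Finset (Prob 𝒜), IsGrid ε G ∧ (G.card : ℝ) ≤ c * ε ^ (-((A : ℝ) - 1)) := by
  refine ⟨(2 * A + 2 : ℝ) ^ (A - 1), fun 𝒜 _ h𝒜 ε h0 h1 => ?_⟩
  have : Nonempty 𝒜 := Fintype.card_pos_iff.1 (by omega)
  obtain ⟨G, hG, hc⟩ := exists_grid (𝒜 := 𝒜) h0 h1
  refine ⟨G, hG, hc.trans_eq ?_⟩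
  have e : ((A : ℝ) - 1) = ((A - 1 : ℕ) : ℝ) := by push_cast [hA]; ring
  rw [h𝒜, div_pow, e, Real.rpow_neg h0.le, Real.rpow_natCast, div_eq_mul_inv]

theorem IsGrid.nonempty [Nonempty 𝒜] {ε : ℝ} {G : Finset (Prob 𝒜)} (hG : IsGrid ε G) :
    G.Nonempty :=
  let ⟨p, hp, _⟩ := hG (Classical.arbitrary _)
  ⟨p, hp⟩

theorem mem_target {G : Finset (Prob 𝒜)} {ε : ℝ} {x : PayoffSpace G} :
    x ∈ target G ε ↔ ∑ i, |x i| ≤ ε := by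
  simp [target, l1, Fintype.sum_prod_type]

theorem convex_target (G : Finset (Prob 𝒜)) (ε : ℝ) : Convex ℝ (target G ε) := by
  intro x hx y hy s t hs ht hst
  rw [mem_target] at *
  calc ∑ i, |(s • x + t • y) i| ≤ ∑ i, (s * |x i| + t * |y i|) := by
        refine Finset.sum_le_sum fun i _ => (abs_add_le _ _).trans_eq ?_
        simp [abs_mul, abs_of_nonneg hs, abs_of_nonneg ht]
    _ = s * ∑ i, |x i| + t * ∑ i, |y i| := by
        rw [Finset.sum_add_distrib, Finset.mul_sum, Finset.mul_sum]
    _ ≤ s * ε + t * ε := by gcongr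
    _ = ε := by rw [← add_mul, hst, one_mul]

theorem isClosed_target (G : Finset (Prob 𝒜)) (ε : ℝ) : IsClosed (target G ε) := by
  have : target G ε = {x | ∑ i, |x i| ≤ ε} := Set.ext fun _ => mem_target
  rw [this]
  exact isClosed_le (by fun_prop) continuous_const

theorem zero_mem_target (G : Finset (Prob 𝒜)) {ε : ℝ} (h : 0 ≤ ε) : 0 ∈ target G ε := by
  simpa [mem_target] using h

theorem exists_isProjection_target (G : Finset (Prob 𝒜)) {ε : ℝ} (h : 0 ≤ ε)
    (x : PayoffSpace G) :
    ∃ π, IsProjection (target G ε) x π ∧ ∀ y ∈ target G ε, inner ℝ (x - π) (y - π) ≤ 0 := by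
  obtain ⟨π, hπ, hmin⟩ := exists_norm_eq_iInf_of_complete_convex ⟨0, zero_mem_target G h⟩
    (isClosed_target G ε).isComplete (convex_target G ε) x
  refine ⟨π, ⟨hπ, fun y hy => ?_⟩,
    (norm_eq_iInf_iff_real_inner_le_zero (convex_target G ε) hπ).1 hmin⟩
  rw [hmin]
  exact ciInf_le ⟨0, by rintro _ ⟨w, rfl⟩; exact norm_nonneg _⟩ (⟨y, hy⟩ : target G ε)

theorem payoff_apply (G : Finset (Prob 𝒜)) (p : Prob 𝒜) (a : 𝒜) (q : G) (b : 𝒜) :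
    payoff G p a (q, b) = open Classical in
      if (q : Prob 𝒜) = p then (p : 𝒜 → ℝ) b - dirac a b else 0 := by
  simp [payoff]

/-- The mean of δ_a under q is q, so the mean payoff has p - q as its only component. -/
theorem sum_smul_payoff_mem_target {G : Finset (Prob 𝒜)} {ε : ℝ} {p : Prob 𝒜} {q : Prob 𝒜}
    (h : l1 ((p : 𝒜 → ℝ) - (q : 𝒜 → ℝ)) ≤ ε) (hp : p ∈ G) :
    ∑ a, q.1 a • payoff G p a ∈ target G ε := by
  classical
  refine le_trans (le_of_eq ?_) h
  rw [Finset.sum_eq_single (⟨p, hp⟩ : G)]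
  · congr 1
    ext b
    have : ∑ a, q.1 a * dirac a b = q.1 b := by
      simp [dirac, Pi.single_apply]
    simp only [WithLp.ofLp_sum, WithLp.ofLp_smul, Finset.sum_apply, Pi.smul_apply, payoff_apply,
      if_true, smul_eq_mul, mul_sub, Finset.sum_sub_distrib, this, ← Finset.sum_mul, Pi.sub_apply]
    rw [q.2.2, one_mul]
    rfl
  · intro r _ hr
    have hr' : (r : Prob 𝒜) ≠ p := fun h => hr (Subtype.ext h)
    simp [l1, payoff_apply, hr']
  · simp

/-- Against a known law q, a grid point near q has its mean payoff in the target, and the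
obtuse-angle property of the projection gives the sign. Minimax then exchanges the quantifiers. -/
theorem exists_approachability_law [Nonempty 𝒜] {ε : ℝ} (h0 : 0 ≤ ε) {G : Finset (Prob 𝒜)}
    (hG : IsGrid ε G) (m : PayoffSpace G) :
    ∃ ψ : PMF (Prob 𝒜), ψ.support ⊆ G ∧ ∃ π : PayoffSpace G, IsProjection (target G ε) m π ∧
      ∀ a : 𝒜, inner ℝ (m - π) ((∑ p ∈ G, (ψ p).toReal • payoff G p a) - π) ≤ 0 := by
  classical
  obtain ⟨π, hπ, hle⟩ := exists_isProjection_target G h0 m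
  have : Nonempty G := hG.nonempty.to_subtype
  obtain ⟨x, hx, hxM⟩ := exists_mixed_of_forall_mixed
    (fun (p : G) (a : 𝒜) => inner ℝ (m - π) (payoff G p a - π)) (fun q hq => by
      obtain ⟨p, hp, hpq⟩ := hG ⟨q, hq⟩
      refine ⟨⟨p, hp⟩, le_of_eq_of_le ?_ (hle _ (sum_smul_payoff_mem_target hpq hp))⟩
      have : ∑ a, q a • payoff G p a - π = ∑ a, q a • (payoff G p a - π) := by
        simp only [smul_sub, Finset.sum_sub_distrib, ← Finset.sum_smul, hq.2, one_smul]
      simp only [this, inner_sum, real_inner_smul_right])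
  let f : Prob 𝒜 → ENNReal := fun p => if h : p ∈ G then ENNReal.ofReal (x ⟨p, h⟩) else 0
  have hf : ∑ p ∈ G, f p = 1 := by
    rw [← Finset.sum_coe_sort]
    simp only [f, Finset.coe_mem, dif_pos, Subtype.coe_eta]
    rw [← ENNReal.ofReal_sum_of_nonneg fun i _ => hx.1 i, hx.2, ENNReal.ofReal_one]
  refine ⟨PMF.ofFinset f G hf fun a ha => by simp [f, ha], fun p hp => ?_, π, hπ, fun a => ?_⟩
  · by_contra h
    rw [Finset.mem_coe] at h
    simp [f, h] at hp
  · refine le_of_eq_of_le ?_ (hxM a)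
    have e : ∑ p ∈ G, ((PMF.ofFinset f G hf fun a ha => by simp [f, ha]) p).toReal • payoff G p a
        = ∑ p : G, x p • payoff G p a := by
      rw [← Finset.sum_coe_sort]
      refine Finset.sum_congr rfl fun p _ => ?_
      simp [f, ENNReal.toReal_ofReal (hx.1 p)]
    have : ∑ p : G, x p • payoff G p a - π = ∑ p : G, x p • (payoff G p a - π) := by
      simp only [smul_sub, Finset.sum_sub_distrib, ← Finset.sum_smul, hx.2, one_smul]
    simp only [e, this, inner_sum, real_inner_smul_right]

theorem exists_isBlackwell [Nonempty 𝒜] {ε : ℝ} (h0 : 0 ≤ ε) {G : Finset (Prob 𝒜)}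
    (hG : IsGrid ε G) : ∃ φ : Forecaster 𝒜, IsBlackwell ε G φ := by
  choose ψ hψ hB using exists_approachability_law h0 hG
  exact ⟨fun h => ψ (avgPayoff G h), fun h _ => hψ _, fun h _ => hB _⟩

end Basic

/-! ### Finite histories and their probabilities -/

section Histories

variable {𝒜 : Type u} [Fintype 𝒜]

open Classical in
/-- The histories of length `n` whose `i`-th forecast lies in `Gs i`. -/
noncomputable def histories (Gs : ℕ → Finset (Prob 𝒜)) : ℕ → Finset (List (Prob 𝒜 × 𝒜))
  | 0 => {[]}
  | n + 1 => (histories Gs n ×ˢ (Gs n ×ˢ Finset.univ)).image fun x => x.1 ++ [x.2]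

theorem sum_histories_succ {Gs : ℕ → Finset (Prob 𝒜)} {n : ℕ}
    (F : List (Prob 𝒜 × 𝒜) → ℝ) :
    ∑ h ∈ histories Gs (n + 1), F h
      = ∑ h ∈ histories Gs n, ∑ b, ∑ p ∈ Gs n, F (h ++ [(p, b)]) := by
  classical
  rw [histories, Finset.sum_image, Finset.sum_product]
  · refine Finset.sum_congr rfl fun h _ => ?_
    rw [Finset.sum_product, Finset.sum_comm]
  · rintro ⟨h, x⟩ _ ⟨h', x'⟩ _ e
    have := List.append_inj' e rfl
    simp_all

theorem mem_histories_succ {Gs : ℕ → Finset (Prob 𝒜)} {n : ℕ} {h : List (Prob 𝒜 × 𝒜)} :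
    h ∈ histories Gs (n + 1) ↔
      ∃ h' ∈ histories Gs n, ∃ p ∈ Gs n, ∃ b, h = h' ++ [(p, b)] := by
  classical
  simp only [histories, Finset.mem_image, Finset.mem_product, Finset.mem_univ, and_true]
  constructor
  · rintro ⟨⟨h', p, b⟩, ⟨h1, h2⟩, rfl⟩
    exact ⟨h', h1, p, h2, b, rfl⟩
  · rintro ⟨h', h1, p, h2, b, rfl⟩
    exact ⟨⟨h', p, b⟩, ⟨h1, h2⟩, rfl⟩

theorem length_of_mem_histories {Gs : ℕ → Finset (Prob 𝒜)} {n : ℕ} {h : List (Prob 𝒜 × 𝒜)}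
    (hh : h ∈ histories Gs n) : h.length = n := by
  induction n generalizing h with
  | zero => simpa [histories] using hh
  | succ n ih =>
    obtain ⟨h', h1, p, -, b, rfl⟩ := mem_histories_succ.1 hh
    simp [ih h1]

theorem getElem_mem_of_mem_histories {Gs : ℕ → Finset (Prob 𝒜)} {n : ℕ}
    {h : List (Prob 𝒜 × 𝒜)} (hh : h ∈ histories Gs n) (i : ℕ) (hi : i < h.length) :
    (h[i]).1 ∈ Gs i := by
  induction n generalizing h with
  | zero =>
    simp only [histories, Finset.mem_singleton] at hh
    subst hh
    simp at hi
  | succ n ih =>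
    obtain ⟨h', h1, p, hp, b, rfl⟩ := mem_histories_succ.1 hh
    rw [List.getElem_append]
    split_ifs with hi'
    · exact ih h1 hi'
    · simp only [List.length_append, List.length_singleton] at hi
      have : i = n := by
        have := length_of_mem_histories h1
        omega
      subst this
      simpa using hp

theorem mem_of_mem_drop_histories {Gs : ℕ → Finset (Prob 𝒜)} {n s : ℕ} {G : Finset (Prob 𝒜)}
    (hG : ∀ i, s ≤ i → i < n → Gs i = G) {h : List (Prob 𝒜 × 𝒜)} (hh : h ∈ histories Gs n)
    (x : Prob 𝒜 × 𝒜) (hx : x ∈ h.drop s) : x.1 ∈ G := by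
  obtain ⟨i, hi, rfl⟩ := List.getElem_of_mem hx
  rw [List.length_drop] at hi
  have hl := length_of_mem_histories hh
  rw [List.getElem_drop, ← hG (s + i) (by omega) (by omega)]
  exact getElem_mem_of_mem_histories hh _ _

section

variable {Ω : Type w} {P : ℕ → Ω → Prob 𝒜} {a : ℕ → Ω → 𝒜}

theorem history_succ (n : ℕ) (ω : Ω) :
    history P a (n + 1) ω = history P a n ω ++ [(P n ω, a n ω)] := by
  simp [history, List.range_succ]

theorem length_history (n : ℕ) (ω : Ω) : (history P a n ω).length = n := by
  simp [history]

theorem history_succ_eq_append_iff (n : ℕ) (ω : Ω) (h : List (Prob 𝒜 × 𝒜)) (p : Prob 𝒜) (b : 𝒜) :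
    history P a (n + 1) ω = h ++ [(p, b)] ↔ history P a n ω = h ∧ a n ω = b ∧ P n ω = p := by
  rw [history_succ]
  constructor
  · intro e
    have := List.append_inj' e rfl
    simp_all
  · rintro ⟨rfl, rfl, rfl⟩
    rfl

end

section Play

variable {ψ : Forecaster 𝒜} {Ω : Type w} [MeasurableSpace Ω] {μ : Measure Ω}
  {P : ℕ → Ω → Prob 𝒜} {a : ℕ → Ω → 𝒜} {Gs : ℕ → Finset (Prob 𝒜)}

theorem IsPlay.measurableSet_history (hp : IsPlay ψ μ P a) (n : ℕ) (h : List (Prob 𝒜 × 𝒜)) :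
    MeasurableSet {ω | history P a n ω = h} := by
  induction n generalizing h with
  | zero => simp [history]
  | succ n ih =>
    rcases List.eq_nil_or_concat h with rfl | ⟨l, ⟨p, b⟩, rfl⟩
    · simp [history_succ]
    · simp only [List.concat_eq_append, history_succ_eq_append_iff]
      exact (ih l).inter ((hp.measurable_outcome n b).inter
        (hp.measurable_forecast n (measurableSet_singleton p)))

theorem IsPlay.real_history_succ (hp : IsPlay ψ μ P a) (n : ℕ) (h : List (Prob 𝒜 × 𝒜))
    (p : Prob 𝒜) (b : 𝒜) :
    μ.real {ω | history P a (n + 1) ω = h ++ [(p, b)]}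
      = μ.real {ω | history P a n ω = h ∧ a n ω = b} * (ψ h p).toReal := by
  simp only [history_succ_eq_append_iff, Measure.real]
  rw [hp.law, ENNReal.toReal_mul]

theorem IsPlay.sum_mul_history_succ (hp : IsPlay ψ μ P a) (n : ℕ)
    (F : List (Prob 𝒜 × 𝒜) → ℝ) :
    ∑ h ∈ histories Gs (n + 1), F h * μ.real {ω | history P a (n + 1) ω = h}
      = ∑ h ∈ histories Gs n, ∑ b, (∑ p ∈ Gs n, (ψ h p).toReal * F (h ++ [(p, b)]))
          * μ.real {ω | history P a n ω = h ∧ a n ω = b} := by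
  rw [sum_histories_succ]
  refine Finset.sum_congr rfl fun h _ => Finset.sum_congr rfl fun b _ => ?_
  rw [Finset.sum_mul]
  refine Finset.sum_congr rfl fun p _ => ?_
  rw [hp.real_history_succ]
  ring

variable [IsProbabilityMeasure μ]

theorem IsPlay.sum_outcome (hp : IsPlay ψ μ P a) (n : ℕ) (h : List (Prob 𝒜 × 𝒜)) :
    ∑ b, μ.real {ω | history P a n ω = h ∧ a n ω = b} = μ.real {ω | history P a n ω = h} := by
  have : {ω | history P a n ω = h} = ⋃ b ∈ (Finset.univ : Finset 𝒜),
      {ω | history P a n ω = h ∧ a n ω = b} := by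
    ext ω
    simp
  rw [this, measureReal_biUnion_finset]
  · intro b _ c _ hbc
    refine Set.disjoint_left.2 fun ω h1 h2 => hbc ?_
    exact h1.2.symm.trans h2.2
  · exact fun b _ => (hp.measurableSet_history n h).inter (hp.measurable_outcome n b)

/-- A one-round supermartingale estimate written with finite sums. The forecast is independent of
the outcome given the past, so a bound holding for each outcome survives any strategy of Nature. -/
theorem IsPlay.sum_mul_history_succ_le (hp : IsPlay ψ μ P a) (n : ℕ)
    (F F' : List (Prob 𝒜 × 𝒜) → ℝ)
    (hF : ∀ h ∈ histories Gs n, ∀ b, ∑ p ∈ Gs n, (ψ h p).toReal * F (h ++ [(p, b)]) ≤ F' h) :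
    ∑ h ∈ histories Gs (n + 1), F h * μ.real {ω | history P a (n + 1) ω = h}
      ≤ ∑ h ∈ histories Gs n, F' h * μ.real {ω | history P a n ω = h} := by
  rw [hp.sum_mul_history_succ]
  refine Finset.sum_le_sum fun h hh => ?_
  rw [← hp.sum_outcome, Finset.mul_sum]
  exact Finset.sum_le_sum fun b _ => mul_le_mul_of_nonneg_right (hF h hh b) measureReal_nonneg

theorem sum_toReal_eq_one {α : Type*} (q : PMF α) {s : Finset α} (h : q.support ⊆ s) :
    ∑ x ∈ s, (q x).toReal = 1 := by
  have h0 : ∑' x, q x = ∑ x ∈ s, q x := tsum_eq_sum fun x hx => by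
    by_contra hne
    exact hx (h ((q.mem_support_iff x).2 hne))
  rw [← ENNReal.toReal_sum fun x _ => q.apply_ne_top x, ← h0, q.tsum_coe, ENNReal.toReal_one]

theorem IsPlay.sum_history (hp : IsPlay ψ μ P a)
    (hs : ∀ n, ∀ h ∈ histories Gs n, (ψ h).support ⊆ Gs n) (n : ℕ) :
    ∑ h ∈ histories Gs n, μ.real {ω | history P a n ω = h} = 1 := by
  induction n with
  | zero => simp [histories, history]
  | succ n ih =>
    have := hp.sum_mul_history_succ (Gs := Gs) n (fun _ => 1)
    simp only [one_mul, mul_one] at this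
    rw [this, ← ih]
    refine Finset.sum_congr rfl fun h hh => ?_
    rw [sum_toReal_eq_one _ (hs n h hh)]
    simp [hp.sum_outcome]

theorem IsPlay.real_history_mem (hp : IsPlay ψ μ P a) (n : ℕ)
    (s : Finset (List (Prob 𝒜 × 𝒜))) :
    μ.real {ω | history P a n ω ∈ s} = ∑ h ∈ s, μ.real {ω | history P a n ω = h} := by
  have : {ω | history P a n ω ∈ s} = ⋃ h ∈ s, {ω | history P a n ω = h} := by
    ext ω
    simp
  rw [this, measureReal_biUnion_finset]
  · intro b _ c _ hbc
    exact Set.disjoint_left.2 fun ω h1 h2 => hbc (h1.symm.trans h2)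
  · exact fun h _ => hp.measurableSet_history n h

/-- For each length, the finitely many listed histories carry total mass one. -/
theorem IsPlay.ae_history_mem (hp : IsPlay ψ μ P a)
    (hs : ∀ n, ∀ h ∈ histories Gs n, (ψ h).support ⊆ Gs n) :
    ∀ᵐ ω ∂μ, ∀ n, history P a n ω ∈ histories Gs n := by
  rw [ae_all_iff]
  intro n
  have h1 := hp.real_history_mem n (histories Gs n)
  rw [hp.sum_history hs] at h1
  have hm : MeasurableSet {ω | history P a n ω ∈ histories Gs n} := by
    have : {ω | history P a n ω ∈ histories Gs n}
        = ⋃ h ∈ histories Gs n, {ω | history P a n ω = h} := by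
      ext ω
      simp
    rw [this]
    exact Finset.measurableSet_biUnion _ fun h _ => hp.measurableSet_history n h
  rw [Measure.real, ENNReal.toReal_eq_one_iff] at h1
  exact (mem_ae_iff_prob_eq_one hm).2 h1

/-- Markov's inequality along a play. -/
theorem IsPlay.measure_le_of_sum_le (hp : IsPlay ψ μ P a)
    (hs : ∀ n, ∀ h ∈ histories Gs n, (ψ h).support ⊆ Gs n) (n : ℕ)
    {F : List (Prob 𝒜 × 𝒜) → ℝ} (hF : ∀ h, 0 ≤ F h) {x K : ℝ} (hx : 0 < x)
    (hK : ∑ h ∈ histories Gs n, F h * μ.real {ω | history P a n ω = h} ≤ K) :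
    μ {ω | x ≤ F (history P a n ω)} ≤ ENNReal.ofReal (K / x) := by
  classical
  set s := (histories Gs n).filter fun h => x ≤ F h
  have h1 : μ {ω | x ≤ F (history P a n ω)} ≤ μ {ω | history P a n ω ∈ s} := by
    refine measure_mono_ae ?_
    filter_upwards [hp.ae_history_mem hs] with ω hω hx
    exact Finset.mem_filter.2 ⟨hω n, hx⟩
  refine h1.trans ?_
  rw [← ofReal_measureReal]
  refine ENNReal.ofReal_le_ofReal ?_
  rw [hp.real_history_mem, le_div_iff₀ hx, Finset.sum_mul]
  refine le_trans ?_ hK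
  calc ∑ h ∈ s, μ.real {ω | history P a n ω = h} * x
      ≤ ∑ h ∈ s, F h * μ.real {ω | history P a n ω = h} := by
        refine Finset.sum_le_sum fun h hh => ?_
        rw [mul_comm]
        exact mul_le_mul_of_nonneg_right (Finset.mem_filter.1 hh).2 measureReal_nonneg
    _ ≤ _ := Finset.sum_le_sum_of_subset_of_nonneg (Finset.filter_subset _ _)
        fun h _ _ => mul_nonneg (hF h) measureReal_nonneg

end Play

end Histories

/-! ### Exponential moments and tails of the deviation -/

theorem norm_le_sum_abs {ι : Type*} [Fintype ι] (x : EuclideanSpace ℝ ι) : ‖x‖ ≤ ∑ i, |x i| := by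
  rw [EuclideanSpace.norm_eq]
  refine Real.sqrt_le_iff.2 ⟨Finset.sum_nonneg fun _ _ => abs_nonneg _, ?_⟩
  exact Finset.sum_sq_le_sq_sum_of_nonneg fun _ _ => abs_nonneg _

/-- Hoeffding's argument: on [-c, c] the exponential lies below its chord, whose slope is
nonnegative, so a nonpositive mean leaves at most cosh c. -/
theorem sum_mul_exp_le {ι : Type*} {s : Finset ι} {v y : ι → ℝ} {c : ℝ} (hv : ∀ i ∈ s, 0 ≤ v i)
    (hv1 : ∑ i ∈ s, v i = 1) (hy : ∀ i ∈ s, |y i| ≤ c) (hvy : ∑ i ∈ s, v i * y i ≤ 0) :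
    ∑ i ∈ s, v i * Real.exp (y i) ≤ Real.exp (c ^ 2 / 2) := by
  refine le_trans ?_ (Real.cosh_le_exp_half_sq c)
  obtain ⟨i₀, hi₀⟩ : s.Nonempty := by
    by_contra h
    simp [Finset.not_nonempty_iff_eq_empty.1 h] at hv1
  have hc : 0 ≤ c := (abs_nonneg _).trans (hy i₀ hi₀)
  have key : ∀ i ∈ s, Real.exp (y i) ≤ Real.cosh c + y i * (Real.sinh c / c) := by
    intro i hi
    obtain ⟨h1, h2⟩ := abs_le.1 (hy i hi)
    rcases hc.eq_or_lt with rfl | hc'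
    · have : y i = 0 := by linarith
      simp [this]
    · have := convexOn_exp.2 (Set.mem_univ (-c)) (Set.mem_univ c)
        (show 0 ≤ (c - y i) / (2 * c) from div_nonneg (by linarith) (by linarith))
        (show 0 ≤ (c + y i) / (2 * c) from div_nonneg (by linarith) (by linarith))
        (by field_simp; ring)
      simp only [smul_eq_mul] at this
      have e : (c - y i) / (2 * c) * -c + (c + y i) / (2 * c) * c = y i := by field_simp; ring
      rw [e] at this
      refine this.trans_eq ?_
      rw [Real.cosh_eq, Real.sinh_eq]
      field_simp
      ring
  calc ∑ i ∈ s, v i * Real.exp (y i)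
      ≤ ∑ i ∈ s, v i * (Real.cosh c + y i * (Real.sinh c / c)) :=
        Finset.sum_le_sum fun i hi => mul_le_mul_of_nonneg_left (key i hi) (hv i hi)
    _ = Real.cosh c + (∑ i ∈ s, v i * y i) * (Real.sinh c / c) := by
        simp only [mul_add, Finset.sum_add_distrib, ← Finset.sum_mul, hv1, one_mul, ← mul_assoc]
    _ ≤ Real.cosh c := by
        have : 0 ≤ Real.sinh c / c := div_nonneg (Real.sinh_nonneg_iff.2 hc) hc
        linarith [mul_nonneg (neg_nonneg.2 hvy) this]

section Deviation

variable {𝒜 : Type u} [Fintype 𝒜]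

theorem sum_abs_payoff_le (G : Finset (Prob 𝒜)) (p : Prob 𝒜) (a : 𝒜) :
    ∑ i, |payoff G p a i| ≤ 2 := by
  classical
  have h1 : l1 ((p : 𝒜 → ℝ) - dirac a) ≤ 2 := by
    have h2 := l1_add_le (p : 𝒜 → ℝ) (-dirac a)
    have h3 : l1 (p : 𝒜 → ℝ) = 1 := by
      rw [← stdSimplex.sum_eq_one p, l1]
      exact Finset.sum_congr rfl fun b _ => abs_of_nonneg (stdSimplex.zero_le p b)
    have h4 : l1 (-dirac a) = 1 := by
      simp [l1, dirac, Pi.single_apply, apply_ite abs]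
    rw [← sub_eq_add_neg] at h2
    linarith
  rw [Fintype.sum_prod_type]
  by_cases hp : p ∈ G
  · rw [Finset.sum_eq_single (⟨p, hp⟩ : G)]
    · simpa [payoff_apply, l1] using h1
    · intro r _ hr
      have hr' : (r : Prob 𝒜) ≠ p := fun h => hr (Subtype.ext h)
      simp [payoff_apply, hr']
    · simp
  · have (r : G) : (r : Prob 𝒜) ≠ p := fun h => hp (h ▸ r.2)
    simp [payoff_apply, this]

/-- The length of the history times the distance of its average payoff to the target set. -/
noncomputable def deviation (G : Finset (Prob 𝒜)) (ε : ℝ) (h : List (Prob 𝒜 × 𝒜)) : ℝ :=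
  h.length * Metric.infDist (avgPayoff G h) (target G ε)

theorem deviation_nonneg (G : Finset (Prob 𝒜)) (ε : ℝ) (h : List (Prob 𝒜 × 𝒜)) :
    0 ≤ deviation G ε h := mul_nonneg (Nat.cast_nonneg _) Metric.infDist_nonneg

theorem deviation_nil (G : Finset (Prob 𝒜)) (ε : ℝ) : deviation G ε [] = 0 := by
  simp [deviation]

theorem IsProjection.infDist_eq {E : Type*} [NormedAddCommGroup E] {C : Set E} {x π : E}
    (h : IsProjection C x π) : Metric.infDist x C = ‖x - π‖ := by
  refine le_antisymm ((Metric.infDist_le_dist_of_mem h.1).trans_eq (dist_eq_norm _ _)) ?_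
  rw [Metric.le_infDist ⟨π, h.1⟩]
  intro y hy
  rw [dist_eq_norm]
  exact h.2 y hy

theorem length_smul_avgPayoff (G : Finset (Prob 𝒜)) (h : List (Prob 𝒜 × 𝒜)) :
    (h.length : ℝ) • avgPayoff G h = (h.map fun x => payoff G x.1 x.2).sum := by
  rcases h with _ | ⟨x, l⟩
  · simp
  · rw [avgPayoff, smul_smul, mul_inv_cancel₀, one_smul]
    simp only [List.length_cons]
    positivity

/-- The projection π of the old average still lies in the target, so it bounds the new distance; Y
is the cross term when the square is expanded. The constant 3 is 2 for the payoff plus 1 for π, as ε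
≤ 1. -/
theorem IsBlackwell.exists_deviation_append_le {ε : ℝ} (hε : ε ≤ 1) {G : Finset (Prob 𝒜)}
    {φ : Forecaster 𝒜} (hφ : IsBlackwell ε G φ) {h : List (Prob 𝒜 × 𝒜)}
    (hh : ∀ x ∈ h, x.1 ∈ G) :
    ∃ Y : Prob 𝒜 → 𝒜 → ℝ, (∀ b, ∑ p ∈ G, (φ h p).toReal * Y p b ≤ 0) ∧
      ∀ p b, |Y p b| ≤ 3 * deviation G ε h ∧
        deviation G ε (h ++ [(p, b)]) ^ 2 ≤ deviation G ε h ^ 2 + 9 + 2 * Y p b := by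
  obtain ⟨π, hπ, hle⟩ := hφ.2 h hh
  have hsum := sum_toReal_eq_one (φ h) (hφ.1 h hh)
  set m := avgPayoff G h with hm
  have hD : deviation G ε h = h.length * ‖m - π‖ := by rw [deviation, hπ.infDist_eq]
  have hb (p : Prob 𝒜) (b : 𝒜) : ‖payoff G p b - π‖ ≤ 3 := by
    have h1 := (norm_le_sum_abs (payoff G p b)).trans (sum_abs_payoff_le G p b)
    have h2 := (norm_le_sum_abs π).trans (mem_target.1 hπ.1)
    linarith [norm_sub_le (payoff G p b) π]
  refine ⟨fun p b => h.length * inner ℝ (m - π) (payoff G p b - π), fun b => ?_, fun p b => ⟨?_, ?_⟩⟩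
  · have e : ∑ p ∈ G, (φ h p).toReal • payoff G p b - π
        = ∑ p ∈ G, (φ h p).toReal • (payoff G p b - π) := by
      simp only [smul_sub, Finset.sum_sub_distrib, ← Finset.sum_smul, hsum, one_smul]
    have := hle b
    rw [e, inner_sum] at this
    simp only [real_inner_smul_right] at this
    calc _ = h.length * ∑ p ∈ G, (φ h p).toReal * inner ℝ (m - π) (payoff G p b - π) := by
          rw [Finset.mul_sum]
          exact Finset.sum_congr rfl fun p _ => by ring
      _ ≤ 0 := mul_nonpos_of_nonneg_of_nonpos (Nat.cast_nonneg _) this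
  · rw [hD, abs_mul, Nat.abs_cast]
    have := abs_real_inner_le_norm (m - π) (payoff G p b - π)
    have h2 := mul_le_mul_of_nonneg_left (hb p b) (norm_nonneg (m - π))
    calc _ ≤ (h.length : ℝ) * (‖m - π‖ * 3) := by gcongr; linarith
      _ = _ := by ring
  · have h1 : deviation G ε (h ++ [(p, b)])
        ≤ ‖(h.length : ℝ) • (m - π) + (payoff G p b - π)‖ := by
      have hd := Metric.infDist_le_dist_of_mem (x := avgPayoff G (h ++ [(p, b)])) hπ.1
      rw [dist_eq_norm] at hd
      calc deviation G ε (h ++ [(p, b)])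
          ≤ ((h ++ [(p, b)]).length : ℝ) * ‖avgPayoff G (h ++ [(p, b)]) - π‖ := by
            unfold deviation
            gcongr
        _ = ‖((h ++ [(p, b)]).length : ℝ) • (avgPayoff G (h ++ [(p, b)]) - π)‖ := by
            rw [norm_smul, Real.norm_natCast]
        _ = _ := by
            congr 1
            rw [smul_sub, length_smul_avgPayoff, smul_sub, hm, length_smul_avgPayoff]
            simp only [List.map_append, List.sum_append, List.map_cons, List.map_nil,
              List.sum_cons, List.sum_nil, List.length_append, List.length_singleton,
              Nat.cast_add, Nat.cast_one, add_smul, one_smul, add_zero]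
            abel
    have h2 := pow_le_pow_left₀ (deviation_nonneg _ _ _) h1 2
    rw [norm_add_sq_real, norm_smul, real_inner_smul_left, Real.norm_natCast, ← hD] at h2
    have h3 := pow_le_pow_left₀ (norm_nonneg _) (hb p b) 2
    linarith

/-- As |2θY| ≤ 6θD, Hoeffding's bound costs (6θD)²/2 = 18θ²D², which is absorbed by raising θ to θ'.
-/
theorem IsBlackwell.sum_exp_deviation_append_le {ε : ℝ} (hε : ε ≤ 1) {G : Finset (Prob 𝒜)}
    {φ : Forecaster 𝒜} (hφ : IsBlackwell ε G φ) {h : List (Prob 𝒜 × 𝒜)}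
    (hh : ∀ x ∈ h, x.1 ∈ G) {θ θ' : ℝ} (hθ : 0 ≤ θ) (hθ' : θ + 18 * θ ^ 2 ≤ θ') (b : 𝒜) :
    ∑ p ∈ G, (φ h p).toReal * Real.exp (θ * deviation G ε (h ++ [(p, b)]) ^ 2)
      ≤ Real.exp (9 * θ) * Real.exp (θ' * deviation G ε h ^ 2) := by
  obtain ⟨Y, hY, hYb⟩ := hφ.exists_deviation_append_le hε hh
  set D := deviation G ε h
  have h1 := sum_mul_exp_le (s := G) (v := fun p => (φ h p).toReal)
    (y := fun p => 2 * θ * Y p b) (c := 6 * θ * D)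
    (fun p _ => ENNReal.toReal_nonneg) (sum_toReal_eq_one (φ h) (hφ.1 h hh))
    (fun p _ => by
      rw [abs_mul, abs_of_nonneg (by positivity : 0 ≤ 2 * θ)]
      calc 2 * θ * |Y p b| ≤ 2 * θ * (3 * D) := by gcongr; exact (hYb p b).1
        _ = _ := by ring)
    (by
      have := mul_nonpos_of_nonneg_of_nonpos (by positivity : 0 ≤ 2 * θ) (hY b)
      rw [Finset.mul_sum] at this
      refine le_of_eq_of_le (Finset.sum_congr rfl fun p _ => by ring) this)
  calc ∑ p ∈ G, (φ h p).toReal * Real.exp (θ * deviation G ε (h ++ [(p, b)]) ^ 2)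
      ≤ ∑ p ∈ G, (φ h p).toReal * (Real.exp (θ * (D ^ 2 + 9)) * Real.exp (2 * θ * Y p b)) := by
        refine Finset.sum_le_sum fun p _ => ?_
        rw [← Real.exp_add]
        gcongr
        have := mul_le_mul_of_nonneg_left (hYb p b).2 hθ
        linarith
    _ = Real.exp (θ * (D ^ 2 + 9)) * ∑ p ∈ G, (φ h p).toReal * Real.exp (2 * θ * Y p b) := by
        rw [Finset.mul_sum]
        exact Finset.sum_congr rfl fun p _ => by ring
    _ ≤ Real.exp (θ * (D ^ 2 + 9)) * Real.exp ((6 * θ * D) ^ 2 / 2) := by gcongr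
    _ ≤ _ := by
        rw [← Real.exp_add, ← Real.exp_add, Real.exp_le_exp]
        have := mul_le_mul_of_nonneg_right hθ' (sq_nonneg D)
        linarith

variable {ψ φ : Forecaster 𝒜} {Ω : Type w} [MeasurableSpace Ω] {μ : Measure Ω}
  [IsProbabilityMeasure μ] {P : ℕ → Ω → Prob 𝒜} {a : ℕ → Ω → 𝒜} {Gs : ℕ → Finset (Prob 𝒜)}
  {G : Finset (Prob 𝒜)} {ε : ℝ} {s T : ℕ}

/-- The weights θ_t = 1/(18(T+t)) satisfy θ_{t+1} + 18 θ_{t+1}² ≤ θ_t, which with u = T + t reduces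
to u(u+2) ≤ (u+1)². They stay of order 1/T, and each round costs a factor exp(9θ) ≤ exp(1/(2T)).
Agreement with φ is needed only on the window of T rounds after s, which covers restarts. -/
theorem IsPlay.sum_exp_deviation_le (hp : IsPlay ψ μ P a)
    (hs : ∀ n, ∀ h ∈ histories Gs n, (ψ h).support ⊆ Gs n)
    (hε : ε ≤ 1) (hφ : IsBlackwell ε G φ) (hG : ∀ i, s ≤ i → i < s + T → Gs i = G)
    (hψ : ∀ h : List (Prob 𝒜 × 𝒜), s ≤ h.length → h.length < s + T → ψ h = φ (h.drop s))
    {t : ℕ} (ht : t ≤ T) (hT : 1 ≤ T) :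
    ∑ h ∈ histories Gs (s + t),
      Real.exp ((18 * ((T : ℝ) + t))⁻¹ * deviation G ε (h.drop s) ^ 2)
        * μ.real {ω | history P a (s + t) ω = h} ≤ Real.exp (t * (2 * T : ℝ)⁻¹) := by
  have hT' : (1 : ℝ) ≤ T := by exact_mod_cast hT
  induction t with
  | zero =>
    have : ∀ h ∈ histories Gs (s + 0),
      Real.exp ((18 * ((T : ℝ) + (0 : ℕ)))⁻¹ * deviation G ε (h.drop s) ^ 2)
        * μ.real {ω | history P a (s + 0) ω = h} = μ.real {ω | history P a (s + 0) ω = h} := by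
      intro h hh
      have hl := length_of_mem_histories hh
      rw [List.drop_eq_nil_of_le (by omega), deviation_nil]
      simp
    rw [Finset.sum_congr rfl this, hp.sum_history hs]
    simp
  | succ t ih =>
    specialize ih (by omega)
    set θ : ℝ := (18 * ((T : ℝ) + (t + 1 : ℕ)))⁻¹ with hθ
    set θ' : ℝ := (18 * ((T : ℝ) + t))⁻¹ with hθ'
    have hθ0 : 0 ≤ θ := by positivity
    have h9 : 9 * θ ≤ (2 * T : ℝ)⁻¹ := by
      rw [hθ, mul_inv, ← mul_assoc, mul_inv]
      have : ((T : ℝ) + (t + 1 : ℕ))⁻¹ ≤ (T : ℝ)⁻¹ := by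
        gcongr
        exact le_add_of_nonneg_right (Nat.cast_nonneg _)
      linarith
    have hθθ' : θ + 18 * θ ^ 2 ≤ θ' := by
      have hu : 0 < (T : ℝ) + t := by positivity
      rw [hθ, hθ', Nat.cast_succ, ← add_assoc]
      set u := (T : ℝ) + t
      rw [show (18 * (u + 1))⁻¹ + 18 * (18 * (u + 1))⁻¹ ^ 2 = (u + 2) / (18 * (u + 1) ^ 2) by
        field_simp; ring, inv_eq_one_div, div_le_div_iff₀ (by positivity) (by positivity)]
      nlinarith
    rw [← add_assoc]
    refine (hp.sum_mul_history_succ_le (s + t) _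
      (fun h => Real.exp (9 * θ) * Real.exp (θ' * deviation G ε (h.drop s) ^ 2)) ?_).trans ?_
    · intro h hh b
      have hl := length_of_mem_histories hh
      have hmem := mem_of_mem_drop_histories (s := s) (G := G)
        (fun i h1 h2 => hG i h1 (by omega)) hh
      have := hφ.sum_exp_deviation_append_le hε hmem hθ0 hθθ' b
      rw [hG (s + t) (by omega) (by omega), hψ h (by omega) (by omega)]
      simp only [List.drop_append_of_le_length (show s ≤ h.length by omega)]
      exact this
    · simp only [mul_assoc, ← Finset.mul_sum]
      refine (mul_le_mul_of_nonneg_left ih (Real.exp_pos _).le).trans ?_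
      rw [← Real.exp_add, Real.exp_le_exp]
      push_cast
      linarith

/-- Markov's inequality: for t ≤ T the weight θ_t is at least 1/(36T) and the accumulated factor is
at most e. -/
theorem IsPlay.measure_le_deviation_sq (hp : IsPlay ψ μ P a)
    (hs : ∀ n, ∀ h ∈ histories Gs n, (ψ h).support ⊆ Gs n)
    (hε : ε ≤ 1) (hφ : IsBlackwell ε G φ) (hG : ∀ i, s ≤ i → i < s + T → Gs i = G)
    (hψ : ∀ h : List (Prob 𝒜 × 𝒜), s ≤ h.length → h.length < s + T → ψ h = φ (h.drop s))
    {t : ℕ} (ht : t ≤ T) (hT : 1 ≤ T) {x : ℝ} (hx : 0 ≤ x) :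
    μ {ω | x ≤ deviation G ε ((history P a (s + t) ω).drop s) ^ 2}
      ≤ ENNReal.ofReal (Real.exp (1 - x / (36 * T))) := by
  have hT' : (1 : ℝ) ≤ T := by exact_mod_cast hT
  have ht' : (t : ℝ) ≤ T := by exact_mod_cast ht
  have h1 := hp.measure_le_of_sum_le hs (s + t) (fun h => (Real.exp_pos _).le)
    (Real.exp_pos ((18 * ((T : ℝ) + t))⁻¹ * x)) (hp.sum_exp_deviation_le hs hε hφ hG hψ ht hT)
  refine (measure_mono fun ω hω => ?_).trans (h1.trans (ENNReal.ofReal_le_ofReal ?_))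
  · simp only [Set.mem_ofPred_eq] at hω ⊢
    gcongr
  · rw [← Real.exp_sub, Real.exp_le_exp]
    have e1 : (t : ℝ) * (2 * T : ℝ)⁻¹ ≤ 1 := by
      rw [← div_eq_mul_inv, div_le_one (by positivity)]
      linarith
    have e2 : x / (36 * T) ≤ (18 * ((T : ℝ) + t))⁻¹ * x := by
      rw [mul_comm _ x, ← div_eq_mul_inv]
      refine div_le_div_of_nonneg_left hx (by positivity) ?_
      linarith
    linarith

end Deviation

/-! ### From the deviation to the calibration error, uniformly in the test set -/

section CalibrationSum

variable {𝒜 : Type u} [Fintype 𝒜]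

open Classical in
/-- The sum of the vectors `1{p ∈ B} (p - δ_b)` along a history. -/
noncomputable def calSum (B : Set (Prob 𝒜)) (h : List (Prob 𝒜 × 𝒜)) : 𝒜 → ℝ :=
  (h.map fun x => if x.1 ∈ B then (x.1 : 𝒜 → ℝ) - dirac x.2 else 0).sum

theorem calSum_append (B : Set (Prob 𝒜)) (h h' : List (Prob 𝒜 × 𝒜)) :
    calSum B (h ++ h') = calSum B h + calSum B h' := by
  simp [calSum]

theorem l1_coe_sub_dirac_le (p : Prob 𝒜) (b : 𝒜) : l1 ((p : 𝒜 → ℝ) - dirac b) ≤ 2 := by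
  have := sum_abs_payoff_le {p} p b
  rw [Fintype.sum_prod_type, Fintype.sum_eq_single (⟨p, Finset.mem_singleton_self p⟩)] at this
  · simpa [payoff_apply, l1] using this
  · intro q hq
    exact absurd (Subtype.ext (Finset.mem_singleton.1 q.2)) hq

theorem l1_calSum_le (B : Set (Prob 𝒜)) (h : List (Prob 𝒜 × 𝒜)) :
    l1 (calSum B h) ≤ 2 * h.length := by
  classical
  induction h with
  | nil => simp [calSum, l1_zero]
  | cons x h ih =>
    have e : calSum B (x :: h) = calSum B [x] + calSum B h := calSum_append B [x] h
    have h1 : l1 (calSum B [x]) ≤ 2 := by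
      simp only [calSum, List.map_cons, List.map_nil, List.sum_cons, List.sum_nil, add_zero]
      split_ifs
      · exact l1_coe_sub_dirac_le _ _
      · simp [l1_zero]
    rw [e, List.length_cons]
    push_cast
    linarith [l1_add_le (calSum B [x]) (calSum B h)]

theorem calSum_eq_sum {G : Finset (Prob 𝒜)} (B : Set (Prob 𝒜)) {h : List (Prob 𝒜 × 𝒜)}
    (hh : ∀ x ∈ h, x.1 ∈ G) :
    calSum B h = open Classical in
      ∑ p : G, if (p : Prob 𝒜) ∈ B then
        fun b => (h.map fun x => payoff G x.1 x.2).sum (p, b) else 0 := by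
  classical
  induction h with
  | nil => simp [calSum, ← Pi.zero_def]
  | cons x h ih =>
    have e : calSum B (x :: h) = calSum B [x] + calSum B h := calSum_append B [x] h
    rw [e, ih fun y hy => hh y (List.mem_cons_of_mem _ hy)]
    have hx : x.1 ∈ G := hh x List.mem_cons_self
    have e2 : calSum B [x] = ∑ p : G, if (p : Prob 𝒜) ∈ B then
        fun b => payoff G x.1 x.2 (p, b) else 0 := by
      rw [Fintype.sum_eq_single (⟨x.1, hx⟩ : G)]
      · simp only [calSum, List.map_cons, List.map_nil, List.sum_cons, List.sum_nil, add_zero,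
          payoff_apply, if_true]
        rfl
      · intro p hp
        have hp' : (p : Prob 𝒜) ≠ x.1 := fun h => hp (Subtype.ext h)
        simp [payoff_apply, hp', ← Pi.zero_def]
    rw [e2, ← Finset.sum_add_distrib]
    refine Finset.sum_congr rfl fun p _ => ?_
    split_ifs
    · ext b
      simp
    · simp

/-- Grouped by grid point, the sum over B only selects components of the total payoff; adding the
others back makes the bound free of B. -/
theorem l1_calSum_le_sum_abs {G : Finset (Prob 𝒜)} (B : Set (Prob 𝒜))
    {h : List (Prob 𝒜 × 𝒜)} (hh : ∀ x ∈ h, x.1 ∈ G) :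
    l1 (calSum B h) ≤ h.length * ∑ i, |avgPayoff G h i| := by
  classical
  have e : (h.length : ℝ) * ∑ i, |avgPayoff G h i|
      = ∑ p : G, l1 fun b => (h.map fun x => payoff G x.1 x.2).sum (p, b) := by
    rw [← length_smul_avgPayoff]
    simp [l1, Fintype.sum_prod_type, abs_mul, Finset.mul_sum]
  rw [e, calSum_eq_sum B hh]
  refine (l1_sum_le _ _).trans (Finset.sum_le_sum fun p _ => ?_)
  split_ifs
  · exact le_rfl
  · rw [l1_zero]
    exact l1_nonneg _

/-- The projection contributes at most ε; the remainder is bounded by Cauchy–Schwarz over the N·A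
coordinates. -/
theorem sum_abs_avgPayoff_le (G : Finset (Prob 𝒜)) {ε : ℝ} (h0 : 0 ≤ ε) (m : PayoffSpace G) :
    ∑ i, |m i| ≤ ε + √(G.card * Fintype.card 𝒜) * Metric.infDist m (target G ε) := by
  obtain ⟨π, hπ, -⟩ := exists_isProjection_target G h0 m
  rw [hπ.infDist_eq]
  have h1 : ∑ i, |(m - π) i| ≤ √(G.card * Fintype.card 𝒜) * ‖m - π‖ := by
    rw [EuclideanSpace.norm_eq, ← Real.sqrt_mul (by positivity)]
    refine Real.le_sqrt_of_sq_le ?_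
    have := sq_sum_le_card_mul_sum_sq (s := Finset.univ) (f := fun i => |(m - π) i|)
    simpa using this
  have h2 : ∑ i, |m i| ≤ ∑ i, |π i| + ∑ i, |(m - π) i| := by
    rw [← Finset.sum_add_distrib]
    refine Finset.sum_le_sum fun i _ => ?_
    have := abs_add_le (π i) ((m - π) i)
    simpa using this
  linarith [mem_target.1 hπ.1]

theorem l1_calSum_le_deviation {G : Finset (Prob 𝒜)} {ε : ℝ} (h0 : 0 ≤ ε) (B : Set (Prob 𝒜))
    {h : List (Prob 𝒜 × 𝒜)} (hh : ∀ x ∈ h, x.1 ∈ G) :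
    l1 (calSum B h) ≤ h.length * ε + √(G.card * Fintype.card 𝒜) * deviation G ε h := by
  refine (l1_calSum_le_sum_abs B hh).trans ?_
  refine (mul_le_mul_of_nonneg_left (sum_abs_avgPayoff_le G h0 (avgPayoff G h))
    (Nat.cast_nonneg _)).trans_eq ?_
  rw [deviation]
  ring

variable {Ω : Type w} {P : ℕ → Ω → Prob 𝒜} {a : ℕ → Ω → 𝒜}

theorem calVec_eq (T : ℕ) (B : Set (Prob 𝒜)) (ω : Ω) :
    calVec (fun t => P t ω) (fun t => a t ω) T B
      = (T : ℝ)⁻¹ • calSum B (history P a T ω) := by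
  classical
  rw [calVec]
  congr 1
  induction T with
  | zero => simp [history, calSum]
  | succ n ih =>
    rw [Finset.sum_range_succ, ih, history_succ, calSum_append]
    simp [calSum]

theorem sum_l1_calVec_singleton {G : Finset (Prob 𝒜)} {T : ℕ} {ω : Ω}
    (hh : ∀ x ∈ history P a T ω, x.1 ∈ G) :
    ∑ p ∈ G, l1 (calVec (fun t => P t ω) (fun t => a t ω) T {p})
      = ∑ i, |avgPayoff G (history P a T ω) i| := by
  classical
  rw [Fintype.sum_prod_type, ← Finset.sum_coe_sort]
  refine Finset.sum_congr rfl fun p _ => ?_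
  rw [calVec_eq, calSum_eq_sum _ hh, Fintype.sum_eq_single p]
  · simp only [Set.mem_singleton_iff, if_true, l1, avgPayoff, length_history]
    rfl
  · intro q hq
    have : (q : Prob 𝒜) ≠ p := fun h => hq (Subtype.ext h)
    simp [this]

theorem history_add (s t : ℕ) (ω : Ω) :
    history P a (s + t) ω = history P a s ω ++ (history P a (s + t) ω).drop s := by
  have : history P a s ω = (history P a (s + t) ω).take s := by
    simp [history, ← List.map_take, List.take_range]
  rw [this, List.take_append_drop]

theorem regimeStart_one : regimeStart 1 = 0 := by simp [regimeStart]

theorem regimeStart_succ {r : ℕ} (hr : 1 ≤ r) : regimeStart (r + 1) = regimeStart r + 2 ^ r := by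
  simp [regimeStart, Finset.sum_Ico_succ_top hr]

/-- The last regime may be incomplete, so β must bound every initial segment of a regime. -/
theorem l1_calSum_history_le {B : Set (Prob 𝒜)} {ω : Ω} {β : ℕ → ℝ}
    (hβ : ∀ k, 1 ≤ k → ∀ t ≤ 2 ^ k,
      l1 (calSum B ((history P a (regimeStart k + t) ω).drop (regimeStart k))) ≤ β k)
    {r : ℕ} (hr : 1 ≤ r) {t : ℕ} (ht : t ≤ 2 ^ r) :
    l1 (calSum B (history P a (regimeStart r + t) ω)) ≤ ∑ k ∈ Finset.Icc 1 r, β k := by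
  induction r, hr using Nat.le_induction generalizing t with
  | base => simpa [regimeStart_one] using hβ 1 le_rfl t ht
  | succ r hr ih =>
    rw [history_add, calSum_append, Finset.sum_Icc_succ_top (by omega)]
    refine (l1_add_le _ _).trans (add_le_add ?_ (hβ _ (by omega) t ht))
    rw [regimeStart_succ hr]
    exact ih le_rfl

end CalibrationSum

/-! ### Arithmetic of the rate -/

section Rate

theorem regimeEps_pos (A r : ℕ) : 0 < regimeEps A r := Real.rpow_pos_of_pos two_pos _

theorem regimeEps_le_one (A r : ℕ) : regimeEps A r ≤ 1 :=
  Real.rpow_le_one_of_one_le_of_nonpos one_le_two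
    (div_nonpos_of_nonpos_of_nonneg (neg_nonpos.2 (Nat.cast_nonneg _)) (by positivity))

/-- The growth rate of the calibration error accumulated in successive regimes. -/
noncomputable def growth (A : ℕ) : ℝ := (2 : ℝ) ^ ((A : ℝ) / (A + 1))

theorem growth_pow (A k : ℕ) : growth A ^ k = (2 ^ k : ℝ) * regimeEps A k := by
  rw [growth, regimeEps, ← Real.rpow_natCast, ← Real.rpow_mul two_pos.le, ← Real.rpow_natCast,
    ← Real.rpow_add two_pos]
  congr 1
  field_simp
  ring

/-- The growth rate is at least √2 > 4/3; this closes the induction for the geometric sum with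
constant 4. -/
theorem four_le_three_mul_growth {A : ℕ} (hA : 1 ≤ A) : 4 ≤ 3 * growth A := by
  have hA' : (1 : ℝ) ≤ A := by exact_mod_cast hA
  have h1 : (2 : ℝ) ^ (1 / 2 : ℝ) ≤ growth A := by
    refine Real.rpow_le_rpow_of_exponent_le one_le_two ?_
    rw [div_le_div_iff₀ (by norm_num) (by positivity)]
    linarith
  rw [← Real.sqrt_eq_rpow] at h1
  have h2 : (4 / 3 : ℝ) ≤ √2 := Real.le_sqrt_of_sq_le (by norm_num)
  linarith

theorem sum_growth_pow_le {A : ℕ} (hA : 1 ≤ A) (r : ℕ) :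
    ∑ k ∈ Finset.Icc 1 r, growth A ^ k ≤ 4 * growth A ^ r := by
  have h := four_le_three_mul_growth hA
  induction r with
  | zero => simp
  | succ r ih =>
    rw [Finset.sum_Icc_succ_top (by omega), pow_succ]
    have : 0 ≤ growth A ^ r := pow_nonneg (by linarith) _
    nlinarith

/-- The balance behind the choice of ε_k: ε_k^(-(A-1)) 2^k is exactly the square of 2^k ε_k. -/
theorem sqrt_card_mul_sqrt_le {A : ℕ} {c N : ℝ} {k : ℕ} (hN : 0 ≤ N)
    (hc : N ≤ c * regimeEps A k ^ (-((A : ℝ) - 1))) :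
    √(N * A) * √(36 * 2 ^ k * (2 * k)) ≤ √(72 * c * A) * √k * growth A ^ k := by
  have hε := regimeEps_pos A k
  have hc0 : 0 ≤ c := by
    have := Real.rpow_pos_of_pos hε (-((A : ℝ) - 1))
    by_contra h
    nlinarith
  have hg : 0 ≤ growth A ^ k := by rw [growth_pow]; positivity
  have key : regimeEps A k ^ (-((A : ℝ) - 1)) * 2 ^ k = (growth A ^ k) ^ 2 := by
    rw [growth_pow, regimeEps, ← Real.rpow_natCast 2 k, ← Real.rpow_add two_pos,
      ← Real.rpow_natCast _ 2, ← Real.rpow_mul two_pos.le, ← Real.rpow_mul two_pos.le,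
      ← Real.rpow_add two_pos]
    congr 1
    push_cast
    field_simp
    ring
  rw [← Real.sqrt_mul (by positivity), ← Real.sqrt_mul (by positivity)]
  refine Real.sqrt_le_iff.2 ⟨by positivity, ?_⟩
  rw [mul_pow, Real.sq_sqrt (by positivity), ← key]
  have h0 : 0 ≤ (A : ℝ) * (72 * 2 ^ k * k) := by positivity
  have := mul_le_mul_of_nonneg_right hc h0
  linarith

theorem growth_pow_le {A r T : ℕ} (h : 2 ^ r ≤ 2 * T) (hT : 1 ≤ T) :
    growth A ^ r ≤ 2 * ((T : ℝ) * (T : ℝ) ^ (-(1 / ((A : ℝ) + 1)))) := by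
  have hT0 : (0 : ℝ) < T := by exact_mod_cast hT
  have h' : (2 : ℝ) ^ r ≤ 2 * T := by exact_mod_cast h
  have e1 : growth A ^ r = ((2 : ℝ) ^ r) ^ ((A : ℝ) / (A + 1)) := by
    rw [growth, ← Real.rpow_natCast, ← Real.rpow_mul two_pos.le, ← Real.rpow_natCast,
      ← Real.rpow_mul two_pos.le, mul_comm]
  have e2 : (T : ℝ) * (T : ℝ) ^ (-(1 / ((A : ℝ) + 1))) = (T : ℝ) ^ ((A : ℝ) / (A + 1)) := by
    nth_rw 1 [← Real.rpow_one (T : ℝ)]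
    rw [← Real.rpow_add hT0]
    congr 1
    field_simp
    ring
  rw [e1, e2]
  calc ((2 : ℝ) ^ r) ^ ((A : ℝ) / (A + 1)) ≤ (2 * T : ℝ) ^ ((A : ℝ) / (A + 1)) := by gcongr
    _ = (2 : ℝ) ^ ((A : ℝ) / (A + 1)) * (T : ℝ) ^ ((A : ℝ) / (A + 1)) :=
        Real.mul_rpow two_pos.le hT0.le
    _ ≤ _ := by
        gcongr
        nth_rw 2 [← Real.rpow_one 2]
        refine Real.rpow_le_rpow_of_exponent_le one_le_two ?_
        rw [div_le_one (by positivity)]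
        linarith

/-- Here 2T ≤ T², and 2 / ln 2 < 3. -/
theorem le_three_mul_log {r T : ℕ} (h : 2 ^ r ≤ 2 * T) (hT : 2 ≤ T) :
    (r : ℝ) ≤ 3 * Real.log T := by
  have h1 : (2 : ℝ) ^ r ≤ (T : ℝ) ^ 2 := by
    have : 2 ^ r ≤ T ^ 2 := h.trans (by nlinarith)
    exact_mod_cast this
  have h2 := Real.log_le_log (by positivity) h1
  rw [Real.log_pow, Real.log_pow] at h2
  push_cast at h2
  have h3 : (0 : ℝ) ≤ r := Nat.cast_nonneg r
  nlinarith [Real.log_two_gt_d9]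

/-- Since α < 1, the term M/T vanishes even after rescaling, so M may depend on the path without
affecting Γ. -/
theorem tendsto_and_limsup_of_le_rate {u : ℕ → ℝ} {M Γ α : ℝ} (h0 : 0 < α) (h1 : α < 1)
    (hu0 : ∀ T, 0 ≤ u T)
    (hu : ∀ T : ℕ, 2 ≤ T → u T ≤ M / T + Γ * (√(Real.log T) * (T : ℝ) ^ (-α))) :
    Tendsto u atTop (𝓝 0) ∧
      limsup (fun T : ℕ => (((T : ℝ) ^ α / √(Real.log T) * u T : ℝ) : EReal)) atTop
        ≤ (Γ : EReal) := by
  have hM : Tendsto (fun T : ℕ => M / (T : ℝ)) atTop (𝓝 0) := tendsto_const_div_atTop_nhds_zero_nat M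
  constructor
  · have hl : Tendsto (fun T : ℕ => √(Real.log T) * (T : ℝ) ^ (-α)) atTop (𝓝 0) := by
      have h2 := ((isLittleO_log_rpow_atTop (by linarith : 0 < 2 * α)).tendsto_div_nhds_zero).comp
        tendsto_natCast_atTop_atTop
      have h3 := (Real.continuous_sqrt.tendsto 0).comp h2
      rw [Real.sqrt_zero] at h3
      refine h3.congr fun T => ?_
      have hT : (0 : ℝ) ≤ T := Nat.cast_nonneg T
      have : (T : ℝ) ^ (2 * α) = ((T : ℝ) ^ α) ^ 2 := by
        rw [← Real.rpow_natCast, ← Real.rpow_mul hT, mul_comm]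
        norm_num
      simp only [Function.comp]
      rw [this, Real.sqrt_div' _ (by positivity), Real.sqrt_sq (by positivity), Real.rpow_neg hT,
        div_eq_mul_inv]
    have hs := hM.add (hl.const_mul Γ)
    rw [mul_zero, add_zero] at hs
    refine tendsto_of_tendsto_of_tendsto_of_le_of_le' tendsto_const_nhds hs
      (Eventually.of_forall hu0) ?_
    filter_upwards [eventually_ge_atTop 2] with T hT using hu T hT
  · have hr : Tendsto (fun T : ℕ => |M| * (T : ℝ) ^ (-(1 - α)) + Γ) atTop (𝓝 Γ) := by
      have := (((tendsto_rpow_neg_atTop (by linarith : 0 < 1 - α)).comp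
        tendsto_natCast_atTop_atTop).const_mul |M|).add_const Γ
      simpa using this
    have hr' := (continuous_coe_real_ereal.tendsto Γ).comp hr
    rw [← hr'.limsup_eq]
    refine limsup_le_limsup ?_
    -- From T = 3 on, ln T ≥ 1, so the division by √(ln T) can be dropped from the term in M.
    filter_upwards [eventually_ge_atTop 3] with T hT
    simp only [Function.comp]
    rw [EReal.coe_le_coe_iff]
    have hT0 : (0 : ℝ) < T := by
      have : 0 < T := by omega
      exact_mod_cast this
    have hlog : 1 ≤ Real.log T := by
      rw [Real.le_log_iff_exp_le hT0]
      have : (3 : ℝ) ≤ T := by exact_mod_cast hT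
      linarith [Real.exp_one_lt_d9]
    have hsq : 1 ≤ √(Real.log T) := by rwa [Real.one_le_sqrt]
    have hα : 0 < (T : ℝ) ^ α := Real.rpow_pos_of_pos hT0 _
    calc (T : ℝ) ^ α / √(Real.log T) * u T
        ≤ (T : ℝ) ^ α / √(Real.log T) * (M / T + Γ * (√(Real.log T) * (T : ℝ) ^ (-α))) := by
          gcongr
          exact hu T (by omega)
      _ = (T : ℝ) ^ α / T * M / √(Real.log T) + Γ := by
          rw [Real.rpow_neg hT0.le]
          field_simp
      _ ≤ (T : ℝ) ^ α / T * |M| / 1 + Γ := by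
          gcongr
          exact le_abs_self M
      _ = _ := by
          rw [neg_sub, Real.rpow_sub_one hT0.ne']
          ring

end Rate

/-! ### Borel–Cantelli and almost sure bounds -/

section AlmostSure

variable {𝒜 : Type u} [Fintype 𝒜]

/-- The tail bound with window equal to the elapsed time n + 1 and x = (η(n+1))² decays
exponentially in n; then η runs over the values 1/(j+1). -/
theorem IsBlackwell.ae_tendsto_infDist {ε : ℝ} (h1 : ε ≤ 1) {G : Finset (Prob 𝒜)}
    {φ : Forecaster 𝒜} (hφ : IsBlackwell ε G φ) {Ω : Type w} [MeasurableSpace Ω] {μ : Measure Ω}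
    [IsProbabilityMeasure μ] {P : ℕ → Ω → Prob 𝒜} {a : ℕ → Ω → 𝒜} (hp : IsPlay φ μ P a) :
    ∀ᵐ ω ∂μ, (∀ n, ∀ x ∈ history P a n ω, x.1 ∈ G) ∧
      Tendsto (fun n => Metric.infDist (avgPayoff G (history P a n ω)) (target G ε))
        atTop (𝓝 0) := by
  have hmem : ∀ n, ∀ h ∈ histories (fun _ => G) n, ∀ x ∈ h, x.1 ∈ G := fun n h hh x hx =>
    mem_of_mem_drop_histories (s := 0) (fun _ _ _ => rfl) hh x (by simpa using hx)
  have hs : ∀ n, ∀ h ∈ histories (fun _ => G) n, (φ h).support ⊆ G := fun n h hh =>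
    hφ.1 h (hmem n h hh)
  have key (j : ℕ) : ∀ᵐ ω ∂μ, ∀ᶠ n : ℕ in atTop,
      Metric.infDist (avgPayoff G (history P a (n + 1) ω)) (target G ε) < 1 / ((j : ℝ) + 1) := by
    set η : ℝ := 1 / ((j : ℝ) + 1) with hη
    have hη0 : 0 < η := by positivity
    have hbound (n : ℕ) : μ {ω | (η * (n + 1 : ℕ)) ^ 2 ≤ deviation G ε (history P a (n + 1) ω) ^ 2}
        ≤ ENNReal.ofReal (Real.exp 1 * Real.exp (n * (-(η ^ 2 / 36)))) := by
      have := hp.measure_le_deviation_sq (Gs := fun _ => G) (s := 0) (T := n + 1) hs h1 hφ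
        (fun _ _ _ => rfl) (fun h _ _ => by simp) (t := n + 1) le_rfl (by omega)
        (sq_nonneg (η * (n + 1 : ℕ)))
      simp only [List.drop_zero, zero_add] at this
      refine this.trans (ENNReal.ofReal_le_ofReal ?_)
      rw [← Real.exp_add, Real.exp_le_exp]
      have hn : (0 : ℝ) < (n + 1 : ℕ) := by positivity
      have e : (η * (n + 1 : ℕ)) ^ 2 / (36 * (n + 1 : ℕ)) = (n + 1 : ℕ) * (η ^ 2 / 36) := by
        field_simp
      rw [e]
      push_cast
      nlinarith [sq_nonneg η]
    have hsum : Summable fun n : ℕ => Real.exp 1 * Real.exp (n * (-(η ^ 2 / 36))) :=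
      (Real.summable_exp_nat_mul_iff.2 (by rw [neg_lt_zero]; positivity)).mul_left _
    have hBC := ae_eventually_notMem (μ := μ) (s := fun n : ℕ =>
      {ω | (η * (n + 1 : ℕ)) ^ 2 ≤ deviation G ε (history P a (n + 1) ω) ^ 2})
      (ne_top_of_le_ne_top hsum.tsum_ofReal_ne_top (ENNReal.tsum_le_tsum hbound))
    filter_upwards [hBC] with ω hω
    filter_upwards [hω] with n hn
    simp only [not_le] at hn
    have hn' := lt_of_pow_lt_pow_left₀ 2 (by positivity) hn
    rw [deviation, length_history, mul_comm η] at hn'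
    exact lt_of_mul_lt_mul_left hn' (Nat.cast_nonneg _)
  filter_upwards [hp.ae_history_mem hs, ae_all_iff.2 key] with ω hω hω'
  refine ⟨fun n => hmem n _ (hω n), ?_⟩
  rw [← tendsto_add_atTop_iff_nat 1]
  refine tendsto_order.2 ⟨fun b hb => Eventually.of_forall fun n => hb.trans_le
    Metric.infDist_nonneg, fun b hb => ?_⟩
  obtain ⟨j, hj⟩ := exists_nat_one_div_lt hb
  filter_upwards [hω' j] with n hn using hn.trans hj

theorem IsBlackwell.isEpsCalibrated {ε : ℝ} (h0 : 0 ≤ ε) (h1 : ε ≤ 1) {G : Finset (Prob 𝒜)}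
    (hG : IsGrid ε G) {φ : Forecaster 𝒜} (hφ : IsBlackwell ε G φ) :
    IsEpsCalibrated.{u, w} ε G φ := by
  refine ⟨hG, hφ.1, fun Ω _ μ _ P a hp => ?_⟩
  filter_upwards [hφ.ae_tendsto_infDist h1 hp] with ω hω
  have hlim := (hω.2.const_mul √(G.card * Fintype.card 𝒜)).const_add ε
  rw [mul_zero, add_zero] at hlim
  have hlim' := (continuous_coe_real_ereal.tendsto ε).comp hlim
  rw [← hlim'.limsup_eq]
  refine limsup_le_limsup (Eventually.of_forall fun T => ?_)
  simp only [Function.comp]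
  rw [EReal.coe_le_coe_iff, sum_l1_calVec_singleton (hω.1 T)]
  exact sum_abs_avgPayoff_le G h0 _

theorem regime_eq {r i : ℕ} (hr : 1 ≤ r) (h1 : regimeStart r ≤ i)
    (h2 : i < regimeStart r + 2 ^ r) : regime i = r := by
  have h := regimeStart_add_two r hr
  refine Nat.log_eq_of_pow_le_of_lt_pow (by omega) ?_
  rw [pow_succ]
  omega

variable {G : ℕ → Finset (Prob 𝒜)} {φ : ℕ → Forecaster 𝒜} {A : ℕ} {c : ℝ}

theorem metaForecaster_support_subset
    (hφ : ∀ r, 1 ≤ r → PlaysIn (φ r) (G r)) (n : ℕ) (h : List (Prob 𝒜 × 𝒜))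
    (hh : h ∈ histories (fun n => G (regime n)) n) :
    (metaForecaster φ h).support ⊆ G (regime n) := by
  rw [metaForecaster, length_of_mem_histories hh]
  obtain ⟨h1, h2, h3⟩ := regime_spec n
  refine hφ _ h1 _ (mem_of_mem_drop_histories (fun i hi hi' => ?_) hh)
  rw [regime_eq h1 hi (by omega)]

variable {Ω : Type w} [MeasurableSpace Ω] {μ : Measure Ω} [IsProbabilityMeasure μ]
  {P : ℕ → Ω → Prob 𝒜} {a : ℕ → Ω → 𝒜}

/-- At x = 72 k 2^k each time of regime k fails with probability at most exp(1 - 2k). There are 2^k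
+ 1 ≤ 2 e^k times, so the regime fails with probability at most 2 exp(1 - k), which is summable. -/
theorem ae_eventually_deviation_le (hφ : ∀ r, 1 ≤ r → IsBlackwell (regimeEps A r) (G r) (φ r))
    (hp : IsPlay (metaForecaster φ) μ P a) :
    ∀ᵐ ω ∂μ, ∀ᶠ k : ℕ in atTop, ∀ t ≤ 2 ^ k, deviation (G k) (regimeEps A k)
      ((history P a (regimeStart k + t) ω).drop (regimeStart k)) ≤ √(36 * 2 ^ k * (2 * k)) := by
  have hs := metaForecaster_support_subset (G := G) fun r hr => (hφ r hr).1
  let bad (k t : ℕ) : Set Ω := {ω | 36 * 2 ^ k * (2 * k) ≤ deviation (G k) (regimeEps A k)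
      ((history P a (regimeStart k + t) ω).drop (regimeStart k)) ^ 2}
  have hbad (k : ℕ) (hk : 1 ≤ k) (t : ℕ) (ht : t ≤ 2 ^ k) :
      μ (bad k t) ≤ ENNReal.ofReal (Real.exp (1 - 2 * k)) := by
    have := hp.measure_le_deviation_sq (s := regimeStart k) (T := 2 ^ k) hs
      (regimeEps_le_one A k) (hφ k hk)
      (fun i h1 h2 => by rw [regime_eq hk h1 h2])
      (fun h h1 h2 => by rw [metaForecaster, regime_eq hk h1 h2])
      ht Nat.one_le_two_pow (by positivity : (0 : ℝ) ≤ 36 * 2 ^ k * (2 * k))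
    refine this.trans_eq ?_
    congr 3
    push_cast
    field_simp
  have hbound (j : ℕ) : μ (⋃ t ∈ Finset.range (2 ^ (j + 1) + 1), bad (j + 1) t)
      ≤ ENNReal.ofReal (2 * Real.exp (j * (-1))) := by
    refine (measure_biUnion_finset_le _ _).trans ?_
    refine (Finset.sum_le_sum fun t ht => hbad (j + 1) (by omega) t
      (Nat.lt_succ_iff.1 (Finset.mem_range.1 ht))).trans ?_
    rw [Finset.sum_const, Finset.card_range, nsmul_eq_mul, ← ENNReal.ofReal_natCast,
      ← ENNReal.ofReal_mul (Nat.cast_nonneg _)]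
    refine ENNReal.ofReal_le_ofReal ?_
    have h2 : (2 : ℝ) ^ (j + 1) ≤ Real.exp (j + 1 : ℕ) := by
      rw [← mul_one ((j + 1 : ℕ) : ℝ), Real.exp_nat_mul]
      gcongr
      linarith [Real.add_one_le_exp 1]
    have h3 : (1 : ℝ) ≤ Real.exp (j + 1 : ℕ) := Real.one_le_exp (Nat.cast_nonneg _)
    calc ((2 ^ (j + 1) + 1 : ℕ) : ℝ) * Real.exp (1 - 2 * (j + 1 : ℕ))
        ≤ (2 * Real.exp (j + 1 : ℕ)) * Real.exp (1 - 2 * (j + 1 : ℕ)) := by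
          gcongr
          push_cast at h2 h3 ⊢
          linarith
      _ = _ := by
          rw [mul_assoc, ← Real.exp_add]
          congr 2
          push_cast
          ring
  have hsum : Summable fun j : ℕ => 2 * Real.exp (j * (-1 : ℝ)) :=
    (Real.summable_exp_nat_mul_iff.2 (by norm_num)).mul_left _
  have hBC := ae_eventually_notMem (μ := μ)
    (ne_top_of_le_ne_top hsum.tsum_ofReal_ne_top (ENNReal.tsum_le_tsum hbound))
  filter_upwards [hBC] with ω hω
  obtain ⟨j₀, hj₀⟩ := eventually_atTop.1 hω
  filter_upwards [eventually_ge_atTop (j₀ + 1)] with k hk t ht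
  obtain ⟨j, rfl⟩ : ∃ j, k = j + 1 := ⟨k - 1, by omega⟩
  have hj := hj₀ j (by omega)
  simp only [Set.mem_iUnion, Finset.mem_range, exists_prop, not_exists, not_and] at hj
  exact Real.le_sqrt_of_sq_le (not_le.1 (hj t (Nat.lt_succ_iff.2 ht))).le

/-- The pathwise rate of the meta-forecaster. -/
theorem ae_exists_unifScore_le (hA : 1 ≤ A) (hcard : Fintype.card 𝒜 = A)
    (hφ : ∀ r, 1 ≤ r → ((G r).card : ℝ) ≤ c * regimeEps A r ^ (-((A : ℝ) - 1)) ∧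
      IsBlackwell (regimeEps A r) (G r) (φ r))
    (hp : IsPlay (metaForecaster φ) μ P a) :
    ∀ᵐ ω ∂μ, ∃ M : ℝ, ∀ T : ℕ, 2 ≤ T →
      unifScore (fun t => P t ω) (fun t => a t ω) T
        ≤ M / T + 16 * (1 + √(72 * c * A)) *
          (√(Real.log T) * (T : ℝ) ^ (-(1 / ((A : ℝ) + 1)))) := by
  have hs := metaForecaster_support_subset (G := G) fun r hr => (hφ r hr).2.1
  filter_upwards [ae_eventually_deviation_le (fun r hr => (hφ r hr).2) hp,
    hp.ae_history_mem hs] with ω hdev hmem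
  obtain ⟨k₀, hk₀⟩ := eventually_atTop.1 hdev
  set C := √(72 * c * A) with hC
  have hC0 : 0 ≤ C := Real.sqrt_nonneg _
  have hg (k : ℕ) : 0 ≤ growth A ^ k := by
    rw [growth_pow]
    exact mul_nonneg (by positivity) (regimeEps_pos A k).le
  -- Regimes before the path-dependent k₀ get the trivial bound of 2 per round, a total that does
  -- not depend on T or B.
  refine ⟨∑ k ∈ Finset.range k₀, 2 * 2 ^ k, fun T hT => ?_⟩
  set M : ℝ := ∑ k ∈ Finset.range k₀, 2 * 2 ^ k with hM
  let β (k : ℕ) : ℝ := (if k < k₀ then 2 * 2 ^ k else 0) + (1 + C) * √k * growth A ^ k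
  have hβ (B : Set (Prob 𝒜)) (k : ℕ) (hk : 1 ≤ k) (t : ℕ) (ht : t ≤ 2 ^ k) :
      l1 (calSum B ((history P a (regimeStart k + t) ω).drop (regimeStart k))) ≤ β k := by
    have ht' : (t : ℝ) ≤ 2 ^ k := by exact_mod_cast ht
    have hlen : ((history P a (regimeStart k + t) ω).drop (regimeStart k)).length = t := by
      rw [List.length_drop, length_history]
      omega
    simp only [β]
    split_ifs with hlt
    · refine (l1_calSum_le _ _).trans ?_
      rw [hlen]
      have : 0 ≤ (1 + C) * √k * growth A ^ k := mul_nonneg (by positivity) (hg k)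
      linarith
    · have hin := mem_of_mem_drop_histories (s := regimeStart k) (G := G k)
        (fun i h1 h2 => by rw [regime_eq hk h1 (by omega)]) (hmem (regimeStart k + t))
      refine (l1_calSum_le_deviation (regimeEps_pos A k).le B hin).trans ?_
      rw [hlen, hcard, zero_add]
      have h1 : √((G k).card * A) * deviation (G k) (regimeEps A k)
          ((history P a (regimeStart k + t) ω).drop (regimeStart k)) ≤ C * √k * growth A ^ k :=
        (mul_le_mul_of_nonneg_left (hk₀ k (not_lt.1 hlt) t ht) (Real.sqrt_nonneg _)).trans
          (sqrt_card_mul_sqrt_le (Nat.cast_nonneg _) (hφ k hk).1)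
      have h2 : t * regimeEps A k ≤ growth A ^ k := by
        rw [growth_pow]
        exact mul_le_mul_of_nonneg_right ht' (regimeEps_pos A k).le
      have h3 : 1 ≤ √(k : ℝ) := by
        rw [Real.one_le_sqrt]
        exact_mod_cast hk
      have h4 := mul_le_mul_of_nonneg_right h3 (hg k)
      linarith
  obtain ⟨hr1, hr2, hr3⟩ := regime_spec T
  set r := regime T
  -- Regime r starts after 2^r - 2 rounds, so 2^r ≤ T + 2 ≤ 2T.
  have hpow : 2 ^ r ≤ 2 * T := by
    have := regimeStart_add_two r hr1
    omega
  have hT0 : (0 : ℝ) < T := by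
    have : 0 < T := by omega
    exact_mod_cast this
  have hsumβ : ∑ k ∈ Finset.Icc 1 r, β k ≤ M + 4 * (1 + C) * √r * growth A ^ r := by
    simp only [β, Finset.sum_add_distrib]
    refine add_le_add ?_ ?_
    · rw [← Finset.sum_filter]
      refine Finset.sum_le_sum_of_subset_of_nonneg (fun k hk => ?_) fun _ _ _ => by positivity
      exact Finset.mem_range.2 (Finset.mem_filter.1 hk).2
    · calc ∑ k ∈ Finset.Icc 1 r, (1 + C) * √k * growth A ^ k
          ≤ ∑ k ∈ Finset.Icc 1 r, (1 + C) * √r * growth A ^ k := by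
            refine Finset.sum_le_sum fun k hk => mul_le_mul_of_nonneg_right ?_ (hg k)
            have : k ≤ r := (Finset.mem_Icc.1 hk).2
            gcongr
        _ = (1 + C) * √r * ∑ k ∈ Finset.Icc 1 r, growth A ^ k := by rw [Finset.mul_sum]
        _ ≤ (1 + C) * √r * (4 * growth A ^ r) := by
            gcongr
            exact sum_growth_pow_le hA r
        _ = _ := by ring
  have hsqrt : √(r : ℝ) ≤ 2 * √(Real.log T) := by
    have hlog : 0 ≤ Real.log T := Real.log_natCast_nonneg T
    refine Real.sqrt_le_iff.2 ⟨by positivity, ?_⟩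
    rw [mul_pow, Real.sq_sqrt hlog]
    linarith [le_three_mul_log hpow hT]
  have hgr := growth_pow_le (A := A) hpow (by omega : 1 ≤ T)
  have : Nonempty {B : Set (Prob 𝒜) // MeasurableSet B} := ⟨⟨∅, MeasurableSet.empty⟩⟩
  refine ciSup_le fun B => ?_
  rw [calVec_eq, l1_smul, abs_of_nonneg (by positivity), inv_mul_le_iff₀ hT0]
  have h1 := l1_calSum_history_le (P := P) (a := a) (ω := ω) (hβ B) hr1
    (t := T - regimeStart r) (by omega)
  rw [Nat.add_sub_cancel' hr2] at h1
  refine (h1.trans hsumβ).trans ?_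
  -- The constant 16 is 4 from the geometric sum, 2 from √r and 2 from `growth_pow_le`.
  calc M + 4 * (1 + C) * √r * growth A ^ r
      ≤ M + 4 * (1 + C) * (2 * √(Real.log T)) *
          (2 * ((T : ℝ) * (T : ℝ) ^ (-(1 / ((A : ℝ) + 1))))) := by
        have := hg r
        gcongr
    _ = _ := by
        field_simp
        ring

end AlmostSure

theorem unifScore_nonneg {𝒜 : Type u} [Fintype 𝒜] (P : ℕ → Prob 𝒜) (a : ℕ → 𝒜) (T : ℕ) :
    0 ≤ unifScore P a T :=
  Real.iSup_nonneg fun _ => l1_nonneg _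

end Calibration

theorem mainTheorem2 (A : ℕ) (hA : 1 ≤ A) :
    -- `ε`-grids of cardinality at most `c ε^{-(A-1)}` exist, with `c` depending only on `A`
    (∃ c : ℝ, ∀ (𝒜 : Type u) [Fintype 𝒜], Fintype.card 𝒜 = A →
      ∀ ε : ℝ, 0 < ε → ε ≤ 1 →
        ∃ G : Finset (Prob 𝒜), IsGrid ε G ∧ (G.card : ℝ) ≤ c * ε ^ (-((A : ℝ) - 1))) ∧
    -- on each `ε`-grid there is an approachability forecaster
    (∀ (𝒜 : Type u) [Fintype 𝒜], Fintype.card 𝒜 = A →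
      ∀ (ε : ℝ) (G : Finset (Prob 𝒜)), 0 < ε → IsGrid ε G →
        ∃ φ : Forecaster 𝒜, IsBlackwell ε G φ) ∧
    -- calibration of the forecasters of the regimes, and rate for the meta-forecaster
    (∀ c : ℝ, ∃ Γ : ℝ, ∀ (𝒜 : Type u) [Fintype 𝒜], Fintype.card 𝒜 = A →
      ∀ (G : ℕ → Finset (Prob 𝒜)) (φ : ℕ → Forecaster 𝒜),
        (∀ r, 1 ≤ r → IsGrid (regimeEps A r) (G r) ∧
          ((G r).card : ℝ) ≤ c * regimeEps A r ^ (-((A : ℝ) - 1)) ∧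
          IsBlackwell (regimeEps A r) (G r) (φ r)) →
        (∀ r, 1 ≤ r → IsEpsCalibrated.{u, w} (regimeEps A r) (G r) (φ r)) ∧
        ∀ (Ω : Type w) [MeasurableSpace Ω] (μ : Measure Ω) [IsProbabilityMeasure μ]
          (P : ℕ → Ω → Prob 𝒜) (a : ℕ → Ω → 𝒜), IsPlay (metaForecaster φ) μ P a →
          ∀ᵐ ω ∂μ,
            Tendsto (fun T : ℕ => unifScore (fun t => P t ω) (fun t => a t ω) T) atTop (𝓝 0) ∧
            limsup (fun T : ℕ =>
              (((T : ℝ) ^ (1 / ((A : ℝ) + 1)) / √(Real.log T) *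
                unifScore (fun t => P t ω) (fun t => a t ω) T : ℝ) : EReal)) atTop
              ≤ (Γ : EReal)) := by
  refine ⟨exists_grid_card_le hA, fun 𝒜 _ hcard ε G hε hG => ?_, fun c =>
    ⟨16 * (1 + √(72 * c * A)), fun 𝒜 _ hcard G φ h => ?_⟩⟩
  · have : Nonempty 𝒜 := Fintype.card_pos_iff.1 (by omega)
    exact exists_isBlackwell hε.le hG
  · refine ⟨fun r hr => (h r hr).2.2.isEpsCalibrated (regimeEps_pos A r).le
      (regimeEps_le_one A r) (h r hr).1, fun Ω _ μ _ P a hp => ?_⟩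
    have hA' : (0 : ℝ) < A := by exact_mod_cast hA
    filter_upwards [ae_exists_unifScore_le hA hcard (fun r hr => (h r hr).2) hp] with ω hω
    obtain ⟨M, hM⟩ := hω
    exact tendsto_and_limsup_of_le_rate (by positivity)
      (by rw [div_lt_one (by positivity)]; linarith) (fun T => unifScore_nonneg _ _ T) hM
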